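/- Let $d\ge 1$, let $N_d=\binom{d+2}{2}-1$, and let $\mathbb{P}^{N_d+1}$ have homogeneous coordinates $a_{000d}$ and $a_\alpha$ ($\alpha\in\mathbb{N}^3$, $|\alpha|=d$). Let $U\subset\mathbb{P}^{N_d+1}$ be the open set where $a_{000d}\neq 0$ and at least one $a_\alpha$ is non-zero, and let $$\mathcal{Y}=\Big\{a_{000d}Z_3^d+\sum_{|\alpha|=d}a_\alpha Z_0^{\alpha_0}Z_1^{\alpha_1}Z_2^{\alpha_2}=0\Big\}\subset\mathbb{P}^3\times U,\qquad H=\{Z_3=0\}\subset\mathcal{Y}.$$ Let $p:\overline{J_2^v}(\mathcal{Y})\to\mathcal{Y}$ be the space of logarithmic $2$-jets of $(\mathcal{Y},H)$ tangent to the fibres of $\mathcal{Y}\to U$. Explicitly, $\mathcal{Y}$ is covered by the charts $Z_i\ne0$, $i=0,1,2$. Over such a chart let $z_1,z_2$ be the functions $Z_k/Z_i$ with $k\le 2$, $k\neq i$, let $z_3=Z_3/Z_i$, and normalise $a_{000d}=1$; let $P(z_1,z_2)$ be the polynomial obtained from $\sum_\alpha a_\alpha Z^\alpha$ by setting $Z_i=1$.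 Let $\xi_j^{(1)},\xi_j^{(2)}$ ($j=1,2,3$) be the logarithmic jet coordinates associated with $dz_1,dz_2,dz_3/z_3$ (for a curve outside $H$ these are $z_j',z_j''$ for $j=1,2$, and $(\log z_3)',(\log z_3)''$ for $j=3$). Then $\overline{J_2^v}(\mathcal{Y})$ is defined over the chart by $$z_3^d+P=0,\qquad d z_3^d\xi_3^{(1)}+\sum_{j\le 2}\frac{\partial P}{\partial z_j}\xi_j^{(1)}=0,$$ $$d z_3^d\xi_3^{(2)}+d^2z_3^d\big(\xi_3^{(1)}\big)^2+\sum_{j\le 2}\frac{\partial P}{\partial z_j}\xi_j^{(2)}+\sum_{j,k\le 2}\frac{\partial^2P}{\partial z_j\partial z_k}\xi_j^{(1)}\xi_k^{(1)}=0 .$$ Let $\Sigma$ be the closure in $\overline{J_2^v}(\mathcal{Y})$ of the set of jets over $Z_0\ne0$ for which $\det(\xi_j^{(i)})_{1\le i,j\le2}=0$. Then $$T_{\overline{J_2^v}(\mathcal{Y})}\otimes\mathcal{O}_{\mathbb{P}^3}(7)\otimes\mathcal{O}_{\mathbb{P}^{N_d+1}}(*)$$ is generated by its global sections on $\overline{J_2^v}(\mathcal{Y})\setminus(\Sigma\cup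 p^{-1}(H))$. That is, there is an integer $e\ge 0$, depending only on $d$, such that for every point $x$ of this set and every tangent vector $v$ of $\overline{J_2^v}(\mathcal{Y})$ at $x$ there is a global section of $T_{\overline{J_2^v}(\mathcal{Y})}\otimes\mathcal{O}_{\mathbb{P}^3}(7)\otimes\mathcal{O}_{\mathbb{P}^{N_d+1}}(e)$ over all of $\overline{J_2^v}(\mathcal{Y})$ whose value at $x$ is $v$ (in the local trivialisations of the twists). Here a global section is an algebraic one: it is given on the chart $Z_i\neq0$ by a vector field $V_i$ in the coordinates $(z_j,\xi_j^{(k)},a_\alpha)$ with polynomial coefficients, of degree at most $e$ in the affine coordinates $a_\alpha$ (pole order at most $e$ along $a_{000d}=0$), tangent to $\overline{J_2^v}(\mathcal{Y})$ (which may be singular over $H$, where tangent means annihilating the equations), and on $\overline{J_2^v}(\mathcal{Y})$ over $Z_iZ_j\ne0$ these satisfy $Z_i^7V_i=Z_j^7V_j$. In particular the $V_i$ are meromorphic vector fields on $\overline{J_2^v}(\mathcal{Y})$ whose poles in the $\mathbb{P}^3$-direction have order at most $7$. -/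

import Mathlib

open scoped LinearAlgebra.Projectivization

noncomputable section

namespace LogJets

/-! The universal family `𝒴` and its divisor `H` -/

/-- Exponents `α = (α₀, α₁, α₂) ∈ ℕ³` with `|α| = d`. -/
abbrev Idx (d : ℕ) : Type := Finset.Nat.antidiagonalTuple 3 d

/-- The ternary form `∑_{|α| = d} a_α Z^α`. -/
def form {d : ℕ} (a : Idx d → ℂ) : MvPolynomial (Fin 3) ℂ :=
  ∑ α : Idx d, MvPolynomial.C (a α) * ∏ j, MvPolynomial.X j ^ (α.1 j)

/-- The parameter space `U`. Since the coefficient `a_{000d}` of `Z₃^d` does not vanish on `U`,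
we normalise it to `1`; a point of `U` is then given by the other coefficients `a_α`, which are
not all zero. -/
abbrev Param (d : ℕ) : Type := {a : Idx d → ℂ // a ≠ 0}

/-- `𝒴 ⊂ ℙ³ × U`, with equation `Z₃^d + ∑_{|α| = d} a_α Z^α = 0`. -/
def univY (d : ℕ) : Set (ℙ ℂ (Fin 4 → ℂ) × Param d) :=
  {q | (q.1.rep 3) ^ d + MvPolynomial.eval (fun j : Fin 3 => q.1.rep j.castSucc) (form q.2.1) = 0}

/-- The divisor `H = (Z₃ = 0)` on `𝒴`. -/
def divH (d : ℕ) : Set (univY d) := {q | q.1.1.rep 3 = 0}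

/-! Logarithmic jet coordinates

No point of `𝒴` has `Z₀ = Z₁ = Z₂ = 0`, so `𝒴` is covered by the charts `Z_i ≠ 0`, `i = 0, 1, 2`.
On the chart `Z_i ≠ 0` the bundle of vertical logarithmic 2-jets of `(ℙ³ × U, Z₃ = 0)` is
trivialised by `dw₁, dw₂, dw₃ / w₃`, where `w₁, w₂` are the two functions `Z_k / Z_i`
(`k ≤ 2`, `k ≠ i`, in increasing order) and `w₃ = Z₃ / Z_i`. -/

/-- Names of the coordinates on the vertical logarithmic 2-jets over the chart `Z_i ≠ 0`:
* `w 0 k` is the affine coordinate `w_k` itself, `w 1 k` and `w 2 k` are the jet coordinates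
  `ξ_k^{(1)}` and `ξ_k^{(2)}` (for a curve: the first and second derivatives of `w_k`);
* `l 0` is `w₃`, `l 1` and `l 2` are the logarithmic jet coordinates `ξ_3^{(1)}`, `ξ_3^{(2)}`
  (for a curve outside `w₃ = 0`: the derivatives `(log w₃)'` and `(log w₃)''`);
* `a α` is the coefficient `a_α`. -/
inductive Coord (d : ℕ) : Type
  | w (o : Fin 3) (k : Fin 2)
  | l (o : Fin 3)
  | a (α : Idx d)
  deriving DecidableEq, Fintype

variable {d : ℕ}

/-- The coefficients `a_α` of a point of the chart. -/
def coeffs (x : Coord d → ℂ) : Idx d → ℂ := fun α => x (.a α)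

/-- In the chart `Z_i ≠ 0`: the derivative of order `o` of `(Z₀, Z₁, Z₂)`, normalised by
`Z_i = 1` along the jet. -/
def homJet (i : Fin 3) (x : Coord d → ℂ) (o : Fin 3) : Fin 3 → ℂ :=
  Fin.insertNth (α := fun _ => ℂ) i (if o = 0 then 1 else 0) (fun k : Fin 2 => x (.w o k))

/-- The 2-jet `(f/g, (f/g)', (f/g)'')` of a quotient, from those of `f` and `g`. -/
def quotJet (f g : Fin 3 → ℂ) : Fin 3 → ℂ :=
  ![f 0 / g 0,
    f 1 / g 0 - f 0 * g 1 / g 0 ^ 2,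
    f 2 / g 0 - 2 * f 1 * g 1 / g 0 ^ 2 - f 0 * g 2 / g 0 ^ 2 + 2 * f 0 * g 1 ^ 2 / g 0 ^ 3]

/-- The logarithmic 2-jet `(f/g, (log (f/g))', (log (f/g))'')`, from the logarithmic 2-jet
`(f, (log f)', (log f)'')` and the ordinary 2-jet `(g, g', g'')`. -/
def quotLogJet (f g : Fin 3 → ℂ) : Fin 3 → ℂ :=
  ![f 0 / g 0, f 1 - g 1 / g 0, f 2 - (g 2 / g 0 - (g 1 / g 0) ^ 2)]

/-- The change of coordinates from the chart `Z_i ≠ 0` to the chart `Z_j ≠ 0`, meaningful where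
`Z_j / Z_i = homJet i x 0 j` does not vanish. -/
def transition (d : ℕ) (i j : Fin 3) (x : Coord d → ℂ) : Coord d → ℂ
  | .w o k => quotJet (fun o' => homJet i x o' (j.succAbove k)) (fun o' => homJet i x o' j) o
  | .l o => quotLogJet (fun o' => x (.l o')) (fun o' => homJet i x o' j) o
  | .a α => x (.a α)

/-! The manifold of vertical logarithmic 2-jets of `(𝒴, H)` -/

/-- The three equations of the vertical logarithmic 2-jets of `𝒴` in the chart `Z_i ≠ 0`: the
equation `w₃^d + P_a = 0` of `𝒴`, where `P_a` is the form restricted to `Z_i = 1`, and its first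
and second derivatives along a jet on which `a` is constant, in logarithmic jet coordinates. -/
def eqns (d : ℕ) (i : Fin 3) (x : Coord d → ℂ) : Fin 3 → ℂ :=
  let P := form (coeffs x)
  let Z := homJet i x 0
  let Z' := homJet i x 1
  let Z'' := homJet i x 2
  ![x (.l 0) ^ d + MvPolynomial.eval Z P,
    d * x (.l 0) ^ d * x (.l 1) + ∑ j, MvPolynomial.eval Z (MvPolynomial.pderiv j P) * Z' j,
    d * x (.l 0) ^ d * x (.l 2) + d ^ 2 * x (.l 0) ^ d * x (.l 1) ^ 2
      + ∑ j, MvPolynomial.eval Z (MvPolynomial.pderiv j P) * Z'' j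
      + ∑ j, ∑ k, MvPolynomial.eval Z (MvPolynomial.pderiv j (MvPolynomial.pderiv k P))
          * Z' j * Z' k]

/-- The part of the log jet space over the chart `Z_i ≠ 0`. -/
def jetChart (d : ℕ) (i : Fin 3) : Set (Coord d → ℂ) :=
  {x | coeffs x ≠ 0 ∧ eqns d i x = 0}

/-- Two points of charts are identified when the change of coordinates takes one to the other. -/
def Glue (d : ℕ) (p q : Σ i : Fin 3, jetChart d i) : Prop :=
  homJet p.1 p.2.1 0 q.1 ≠ 0 ∧ q.2.1 = transition d p.1 q.1 p.2.1

/-- The space of vertical logarithmic 2-jets of `(𝒴, H)`, glued from its three charts, with the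
quotient topology. -/
def LogJetSpace (d : ℕ) : Type := Quot (Glue d)

instance (d : ℕ) : TopologicalSpace (LogJetSpace d) :=
  inferInstanceAs (TopologicalSpace (Quot (Glue d)))

/-- The point of the log jet space with given coordinates in the chart `Z_i ≠ 0`. -/
def ofChart (i : Fin 3) (x : jetChart d i) : LogJetSpace d := Quot.mk _ ⟨i, x⟩

/-- Homogeneous coordinates of the base point in `ℙ³` of a log jet. -/
def homPt (i : Fin 3) (x : Coord d → ℂ) : Fin 4 → ℂ :=
  Fin.snoc (α := fun _ => ℂ) (homJet i x 0) (x (.l 0))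

theorem homJet_zero_self (i : Fin 3) (x : Coord d → ℂ) : homJet i x 0 i = 1 := by
  simp [homJet]

theorem homPt_castSucc (i : Fin 3) (x : Coord d → ℂ) (j : Fin 3) :
    homPt i x j.castSucc = homJet i x 0 j := by
  simp only [homPt, Fin.snoc_castSucc]

theorem homPt_three (i : Fin 3) (x : Coord d → ℂ) : homPt i x 3 = x (.l 0) := by
  have h := Fin.snoc_last (α := fun _ : Fin 4 => ℂ) (x (.l 0)) (homJet i x 0)
  exact h

theorem homPt_ne_zero (i : Fin 3) (x : Coord d → ℂ) : homPt i x ≠ 0 := by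
  intro h
  have h1 := congrFun h i.castSucc
  rw [homPt_castSucc, homJet_zero_self] at h1
  exact one_ne_zero h1

theorem homJet_transition (i j : Fin 3) (x : Coord d → ℂ) (h : homJet i x 0 j ≠ 0) (k : Fin 3) :
    homJet j (transition d i j x) 0 k = homJet i x 0 k / homJet i x 0 j := by
  rcases Fin.eq_self_or_eq_succAbove j k with rfl | ⟨k, rfl⟩
  · rw [homJet_zero_self, div_self h]
  · simp [homJet, transition, quotJet]

theorem homPt_transition (i j : Fin 3) (x : Coord d → ℂ) (h : homJet i x 0 j ≠ 0) :
    (homJet i x 0 j) • homPt j (transition d i j x) = homPt i x := by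
  funext k
  rcases Fin.eq_castSucc_or_eq_last k with ⟨k, rfl⟩ | rfl
  · rw [Pi.smul_apply, homPt_castSucc, homPt_castSucc, homJet_transition i j x h, smul_eq_mul,
      mul_div_cancel₀ _ h]
  · change homJet i x 0 j • homPt j _ 3 = homPt i x 3
    rw [homPt_three, homPt_three, smul_eq_mul]
    simp [transition, quotLogJet, mul_div_cancel₀ _ h]

theorem eval_form_smul (a : Idx d → ℂ) (t : ℂ) (Z : Fin 3 → ℂ) :
    MvPolynomial.eval (t • Z) (form a) = t ^ d * MvPolynomial.eval Z (form a) := by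
  simp only [form, map_sum, map_mul, map_prod, map_pow, MvPolynomial.eval_C, MvPolynomial.eval_X,
    Finset.mul_sum]
  refine Finset.sum_congr rfl fun α _ => ?_
  have hα : ∑ j, α.1 j = d := Finset.Nat.mem_antidiagonalTuple.1 α.2
  have h1 : ∏ j, (t • Z) j ^ α.1 j = t ^ d * ∏ j, Z j ^ α.1 j := by
    have h2 : t ^ d = ∏ j, t ^ α.1 j := by rw [Finset.prod_pow_eq_pow_sum, hα]
    rw [h2, ← Finset.prod_mul_distrib]
    simp [mul_pow]
  rw [h1]
  ring

/-- The base point in `𝒴` of a log jet given in a chart. -/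
def projChart (i : Fin 3) (x : jetChart d i) : univY d :=
  ⟨(Projectivization.mk ℂ (homPt i x.1) (homPt_ne_zero i x.1), ⟨coeffs x.1, x.2.1⟩), by
    obtain ⟨t, ht⟩ := Projectivization.exists_smul_eq_mk_rep ℂ (homPt i x.1) (homPt_ne_zero i x.1)
    have h0 : x.1 (.l 0) ^ d + MvPolynomial.eval (homJet i x.1 0) (form (coeffs x.1)) = 0 :=
      congrFun x.2.2 0
    change (Projectivization.mk ℂ (homPt i x.1) (homPt_ne_zero i x.1)).rep 3 ^ d +
      MvPolynomial.eval (fun j : Fin 3 =>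
        (Projectivization.mk ℂ (homPt i x.1) (homPt_ne_zero i x.1)).rep j.castSucc)
        (form (coeffs x.1)) = 0
    rw [← ht]
    have h2 : (fun j : Fin 3 => (t • homPt i x.1) j.castSucc) = (t : ℂ) • homJet i x.1 0 := by
      funext j
      change (t : ℂ) * homPt i x.1 j.castSucc = (t : ℂ) * homJet i x.1 0 j
      rw [homPt_castSucc]
    have h3 : (t • homPt i x.1) 3 = (t : ℂ) * x.1 (.l 0) := by
      change (t : ℂ) * homPt i x.1 3 = _
      rw [homPt_three]
    rw [h2, h3, eval_form_smul, mul_pow, ← mul_add, h0, mul_zero]⟩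

/-- The natural projection `p` from the log jet space to `𝒴`. -/
def proj (d : ℕ) : LogJetSpace d → univY d :=
  Quot.lift (fun q => projChart q.1 q.2) (by
    rintro ⟨i, x⟩ ⟨j, y⟩ ⟨h, hy⟩
    apply Subtype.ext
    refine Prod.ext ?_ (Subtype.ext ?_)
    · refine (Projectivization.mk_eq_mk_iff' ℂ _ _ _ _).2 ⟨homJet i x.1 0 j, ?_⟩
      change _ • homPt j y.1 = homPt i x.1
      have hy' : y.1 = transition d i j x.1 := hy
      rw [hy', homPt_transition i j x.1 h]
    · have hy' : y.1 = transition d i j x.1 := hy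
      change coeffs x.1 = coeffs y.1
      rw [hy']
      rfl)

/-- The Wronskian `det (ξ_k^{(o)})`, `1 ≤ k, o ≤ 2`, in a chart. -/
def wronskian (x : Coord d → ℂ) : ℂ :=
  x (.w 1 0) * x (.w 2 1) - x (.w 1 1) * x (.w 2 0)

/-- `Σ`: the closure in the log jet space of the locus, over the chart `Z₀ ≠ 0`, where the
Wronskian vanishes. -/
def wronskianLocus (d : ℕ) : Set (LogJetSpace d) :=
  closure {q | ∃ x : jetChart d 0, q = ofChart 0 x ∧ wronskian x.1 = 0}

/-! The tangent sheaf and its twists -/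

/-- The (Zariski) tangent space of the log jet space at a point of the chart `Z_i ≠ 0`, in the
coordinates of this chart: the kernel of the differential of the equations. -/
def tangentSpace (i : Fin 3) (x : Coord d → ℂ) : Submodule ℂ (Coord d → ℂ) :=
  LinearMap.ker (fderiv ℂ (eqns d i) x).toLinearMap

/-- A global algebraic section over the log jet space of the tangent sheaf twisted by
`𝒪_{ℙ³}(c)` and `𝒪(e)` of the parameter space.

It is given by a vector field `V_i` with polynomial coefficients in each chart, tangent to the log
jet space, such that the `V_i ⊗ Z_i^c` agree on the overlaps. In particular, `V_0` is a meromorphic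
vector field whose only poles, of order at most `c`, are along `Z₀ = 0`. The parameter space `U` is
contained in `a_{000d} ≠ 0`, where `𝒪(e)` is trivialised by `a_{000d}^e`; we require that the
coefficients have order of pole at most `e` along `a_{000d} = 0`, that is, degree at most `e` in the
affine coordinates `a_α`. -/
structure GlobalSection (d c e : ℕ) where
  /-- The components of the vector field `V_i`. -/
  field : Fin 3 → Coord d → MvPolynomial (Coord d) ℂ
  tangent : ∀ (i : Fin 3), ∀ x ∈ jetChart d i,
    (fun k => MvPolynomial.eval x (field i k)) ∈ tangentSpace i x
  compat : ∀ (i j : Fin 3), ∀ x ∈ jetChart d i, homJet i x 0 j ≠ 0 →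
    fderiv ℂ (transition d i j) x (fun k => MvPolynomial.eval x (field i k)) =
      (homJet i x 0 j) ^ c •
        (fun k => MvPolynomial.eval (transition d i j x) (field j k))
  degree_le : ∀ (i : Fin 3) (k : Coord d), ∀ m ∈ (field i k).support, ∑ α, m (.a α) ≤ e

/-- The value of a section at a point of the chart `Z_i ≠ 0`, in the trivialisation of the twists
by `Z_i^c` and `a_{000d}^e`. -/
def GlobalSection.value {c e : ℕ} (s : GlobalSection d c e) (i : Fin 3) (x : Coord d → ℂ) :
    Coord d → ℂ :=
  fun k => MvPolynomial.eval x (s.field i k)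

end LogJets

end

/-! Over a chart `Z_i ≠ 0`, lift the jet of `(Z₀, Z₁, Z₂)` to vectors `Z, Z', Z''` normalised by
`Z_i = 1`. Up to sign, `W = det (Z, Z', Z'')` is the Wronskian. Where `W` and `Z₃` are nonzero, two
kinds of vector field span the tangent space.

A matrix `M` in `𝔤𝔩₃` acts on `(Z₀, Z₁, Z₂)`, and inversely on the ternary form, with `Z₃` fixed.
This preserves the family, so it gives an untwisted global field, linear in the `a_α`
(`isSection_glField`). Since `Z, Z', Z''` are independent, the nine entries of `M` can prescribe all
nine jet coordinates: six for the plane jet, and three for `Z₃` through the rescaling that restores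
`Z_i = 1`. Subtracting such a field leaves a tangent vector that moves only the `a_α`
(`mem_sectionValues`).

Such a vector is a form `b` of degree `d`, and tangency says that `b` has zero 2-jet along the jet.
Expand `b` at `Z` in the linear forms `ℓ_b = Z_i X_b - Z_b X_i`. Terms divisible by three of them
are tangent by themselves (`isSection_cubic`). A product of two becomes tangent after multiplication
by `W` and subtraction of a multiple of `X_i · det (Z, Z', X)`, which vanishes to first order along
the jet and has second derivative `W` there (`isSection_quadric`). Modulo these, `b` is `X_i^(d-1)`
times a linear form, and tangency makes that form vanish on `Z, Z', Z''`, hence everywhere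
(`paramField_mem_sectionValues`). The quadric fields have weight 6 in the scale of the lift; all
fields are padded to twist 7 by powers of `Z_i`.

It remains to see that `W = 0` and `Z₃ ≠ 0` imply membership in `Σ`, although `Σ` is a closure taken
from `Z₀ ≠ 0`. A point over `Z₀ = 0` is a limit of such jets: move `Z₀` and restore the equations
without touching the Wronskian (`mem_wronskianLocus`). -/

namespace LogJets

open MvPolynomial Topology

variable {d : ℕ}

/-! Constant and linear derivations of ternary polynomials -/

/-- The constant vector field `∑ u_k ∂/∂X_k`. -/
noncomputable def dirD (u : Fin 3 → ℂ) :
    Derivation ℂ (MvPolynomial (Fin 3) ℂ) (MvPolynomial (Fin 3) ℂ) :=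
  mkDerivation ℂ fun k => C (u k)

/-- The linear form with coefficients `c`. -/
noncomputable def linForm (c : Fin 3 → ℂ) : MvPolynomial (Fin 3) ℂ := ∑ k, C (c k) * X k

/-- The linear vector field `∑ (M X)_k ∂/∂X_k`. -/
noncomputable def linD (M : Matrix (Fin 3) (Fin 3) ℂ) :
    Derivation ℂ (MvPolynomial (Fin 3) ℂ) (MvPolynomial (Fin 3) ℂ) :=
  mkDerivation ℂ fun k => linForm (M k)

@[simp] theorem dirD_X (u : Fin 3 → ℂ) (k : Fin 3) : dirD u (X k) = C (u k) := by
  simp [dirD]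

@[simp] theorem dirD_C (u : Fin 3 → ℂ) (c : ℂ) : dirD u (C c) = 0 := derivation_C _ _

@[simp] theorem linD_X (M : Matrix (Fin 3) (Fin 3) ℂ) (k : Fin 3) :
    linD M (X k) = linForm (M k) := by
  simp [linD]

theorem dirD_C_mul (u : Fin 3 → ℂ) (c : ℂ) (p : MvPolynomial (Fin 3) ℂ) :
    dirD u (C c * p) = C c * dirD u p := by
  simp [smul_eq_mul]

theorem dirD_linForm (u c : Fin 3 → ℂ) : dirD u (linForm c) = C (∑ k, c k * u k) := by
  simp [linForm, map_sum]

theorem eval_linForm (Z c : Fin 3 → ℂ) : eval Z (linForm c) = ∑ k, c k * Z k := by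
  simp [linForm]

theorem dirD_add (u v : Fin 3 → ℂ) : dirD (u + v) = dirD u + dirD v :=
  derivation_ext fun k => by simp

theorem dirD_smul (t : ℂ) (u : Fin 3 → ℂ) : dirD (t • u) = t • dirD u :=
  derivation_ext fun k => by simp [smul_eq_C_mul]

theorem dirD_zero : dirD 0 = 0 := derivation_ext fun k => by simp

theorem dirD_apply (u : Fin 3 → ℂ) (p : MvPolynomial (Fin 3) ℂ) :
    dirD u p = ∑ k, C (u k) * pderiv k p := by
  have h : dirD u = ∑ k, u k • pderiv (R := ℂ) k := derivation_ext fun j => by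
    fin_cases j <;> simp [Fin.sum_univ_three, pderiv_X, smul_eq_C_mul]
  rw [h]
  simp [Fin.sum_univ_three, smul_eq_C_mul]

theorem dirD_comm (u v : Fin 3 → ℂ) (p : MvPolynomial (Fin 3) ℂ) :
    dirD u (dirD v p) = dirD v (dirD u p) := by
  have h : ⁅dirD u, dirD v⁆ = 0 := derivation_ext fun k => by
    simp [Derivation.commutator_apply]
  have := congrArg (fun D => D p) h
  simpa [Derivation.commutator_apply, sub_eq_zero] using this

/-- The commutator of a constant and a linear field is again constant. This moves `linD M`
outermost, where evaluation at `Z` turns it into the direction `M Z` (`eval_linD`). -/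
theorem dirD_linD (u : Fin 3 → ℂ) (M : Matrix (Fin 3) (Fin 3) ℂ) (p : MvPolynomial (Fin 3) ℂ) :
    dirD u (linD M p) = linD M (dirD u p) + dirD (M.mulVec u) p := by
  have h : ⁅dirD u, linD M⁆ = dirD (M.mulVec u) := derivation_ext fun k => by
    simp [Derivation.commutator_apply, dirD_linForm, Matrix.mulVec, dotProduct]
  have := congrArg (fun D => D p) h
  simp only [Derivation.commutator_apply] at this
  rw [← this]; ring

theorem linD_apply (M : Matrix (Fin 3) (Fin 3) ℂ) (p : MvPolynomial (Fin 3) ℂ) :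
    linD M p = ∑ k, linForm (M k) * pderiv k p := by
  have h : linD M = ∑ k, linForm (M k) • pderiv (R := ℂ) k := derivation_ext fun j => by
    fin_cases j <;> simp [Fin.sum_univ_three, pderiv_X]
  rw [h]
  simp [Fin.sum_univ_three]

theorem eval_linD (Z : Fin 3 → ℂ) (M : Matrix (Fin 3) (Fin 3) ℂ) (p : MvPolynomial (Fin 3) ℂ) :
    eval Z (linD M p) = eval Z (dirD (M.mulVec Z) p) := by
  rw [linD_apply, dirD_apply]
  simp [eval_linForm, Matrix.mulVec, dotProduct]

theorem linD_one (p : MvPolynomial (Fin 3) ℂ) {n : ℕ} (hp : p.IsHomogeneous n) :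
    linD 1 p = C (n : ℂ) * p := by
  have h := hp.sum_X_mul_pderiv
  rw [linD_apply, map_natCast, ← nsmul_eq_mul, ← h]
  simp [linForm, Matrix.one_apply]

/-- Euler's identity, and its first two derivatives. -/
theorem eval_dirD_self (Z : Fin 3 → ℂ) (p : MvPolynomial (Fin 3) ℂ) {n : ℕ}
    (hp : p.IsHomogeneous n) : eval Z (dirD Z p) = n * eval Z p := by
  have h := eval_linD Z 1 p
  rw [linD_one p hp, Matrix.one_mulVec] at h
  simpa using h.symm

/-- The commutator of `dirD u` with the Euler field `linD 1` is `dirD u`. Working with commutators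
keeps the factor `n - 1` in `ℂ`, so small `n` needs no separate treatment. -/
theorem eval_dirD_dirD_self (Z u : Fin 3 → ℂ) (p : MvPolynomial (Fin 3) ℂ) {n : ℕ}
    (hp : p.IsHomogeneous n) :
    eval Z (dirD Z (dirD u p)) = (n - 1) * eval Z (dirD u p) := by
  have h := eval_linD Z 1 (dirD u p)
  have h2 := dirD_linD u 1 p
  rw [linD_one p hp, dirD_C_mul, Matrix.one_mulVec] at h2
  rw [Matrix.one_mulVec] at h
  rw [← h, eq_sub_of_add_eq h2.symm]
  simp; ring

theorem eval_dirD_dirD_dirD_self (Z u : Fin 3 → ℂ) (p : MvPolynomial (Fin 3) ℂ) {n : ℕ}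
    (hp : p.IsHomogeneous n) :
    eval Z (dirD Z (dirD u (dirD u p))) = (n - 2) * eval Z (dirD u (dirD u p)) := by
  have h := eval_linD Z 1 (dirD u (dirD u p))
  have h2 := dirD_linD u 1 p
  have h3 := dirD_linD u 1 (dirD u p)
  rw [linD_one p hp, dirD_C_mul, Matrix.one_mulVec] at h2
  rw [eq_sub_of_add_eq h2.symm, Matrix.one_mulVec, map_sub, dirD_C_mul] at h3
  rw [Matrix.one_mulVec] at h
  rw [← h, eq_sub_of_add_eq h3.symm]
  simp; ring

/-! The rescaling `X ↦ t X` -/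

theorem bind₁_smul_dirD (t : ℂ) (u : Fin 3 → ℂ) (p : MvPolynomial (Fin 3) ℂ) :
    bind₁ (fun k => C t * X k) (dirD (t • u) p) =
      dirD u (bind₁ (fun k => C t * X k) p) := by
  induction p using MvPolynomial.induction_on with
  | C a => simp
  | add p q hp hq => simp only [map_add, hp, hq]
  | mul_X p k hp => simp [Derivation.leibniz, hp]

theorem eval_smul (t : ℂ) (Z : Fin 3 → ℂ) (p : MvPolynomial (Fin 3) ℂ) :
    eval (t • Z) p = eval Z (bind₁ (fun k => C t * X k) p) := by
  induction p using MvPolynomial.induction_on with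
  | C a => simp
  | add p q hp hq => simp only [map_add, hp, hq]
  | mul_X p k hp => simp [hp]

/-! Coefficient vectors of ternary forms -/

/-- The exponent `α` as a finitely supported function. -/
noncomputable def expo (α : Idx d) : Fin 3 →₀ ℕ := Finsupp.equivFunOnFinite.symm α.1

/-- The coefficients of degree `d` of a ternary polynomial. -/
noncomputable def coeffVec (d : ℕ) : MvPolynomial (Fin 3) ℂ →ₗ[ℂ] (Idx d → ℂ) where
  toFun Q α := coeff (expo α) Q
  map_add' p q := by ext; simp
  map_smul' c p := by ext; simp

theorem coeffVec_apply (Q : MvPolynomial (Fin 3) ℂ) (α : Idx d) :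
    coeffVec d Q α = coeff (expo α) Q := rfl

theorem form_eq_sum_monomial (a : Idx d → ℂ) : form a = ∑ α, monomial (expo α) (a α) := by
  refine Finset.sum_congr rfl fun α _ => ?_
  rw [monomial_eq, Finsupp.prod_fintype _ _ (by simp)]
  rfl

theorem form_isHomogeneous (a : Idx d → ℂ) : (form a).IsHomogeneous d := by
  rw [form_eq_sum_monomial]
  refine IsHomogeneous.sum _ _ _ fun α _ => isHomogeneous_monomial _ ?_
  rw [Finsupp.degree_eq_sum]
  exact Finset.Nat.mem_antidiagonalTuple.1 α.2

theorem form_add (a b : Idx d → ℂ) : form (a + b) = form a + form b := by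
  simp [form_eq_sum_monomial, Finset.sum_add_distrib]

theorem form_smul (c : ℂ) (a : Idx d → ℂ) : form (c • a) = c • form a := by
  simp [form_eq_sum_monomial, Finset.smul_sum, smul_monomial]

theorem expo_injective : Function.Injective (expo (d := d)) := fun _ _ h =>
  Subtype.ext (Finsupp.equivFunOnFinite.symm.injective h)

theorem coeffVec_form (a : Idx d → ℂ) : coeffVec d (form a) = a := by
  classical
  ext α
  simp [coeffVec_apply, form_eq_sum_monomial, coeff_sum, coeff_monomial, expo_injective.eq_iff]

theorem form_coeffVec (Q : MvPolynomial (Fin 3) ℂ) (hQ : Q.IsHomogeneous d) :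
    form (coeffVec d Q) = Q := by
  classical
  ext m
  by_cases hm : m.degree = d
  · have hm' : (⇑m) ∈ Finset.Nat.antidiagonalTuple 3 d := by
      rw [Finset.Nat.mem_antidiagonalTuple, ← Finsupp.degree_eq_sum, hm]
    have : m = expo ⟨⇑m, hm'⟩ := by ext; simp [expo]
    rw [this]
    exact congrFun (coeffVec_form (coeffVec d Q)) ⟨⇑m, hm'⟩
  · rw [hQ.coeff_eq_zero hm, (form_isHomogeneous _).coeff_eq_zero hm]

theorem bind₁_smul_form (t : ℂ) (a : Idx d → ℂ) :
    bind₁ (fun k => C t * X k) (form a) = C (t ^ d) * form a := by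
  refine MvPolynomial.funext fun Z => ?_
  rw [← eval_smul, eval_form_smul]
  simp

theorem eval_smul_dirD_form (t : ℂ) (Z u : Fin 3 → ℂ) (a : Idx d → ℂ) :
    eval (t • Z) (dirD (t • u) (form a)) = t ^ d * eval Z (dirD u (form a)) := by
  rw [eval_smul, bind₁_smul_dirD, bind₁_smul_form, dirD_C_mul]
  simp

theorem eval_smul_dirD_dirD_form (t : ℂ) (Z u v : Fin 3 → ℂ) (a : Idx d → ℂ) :
    eval (t • Z) (dirD (t • u) (dirD (t • v) (form a))) =
      t ^ d * eval Z (dirD u (dirD v (form a))) := by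
  rw [eval_smul, bind₁_smul_dirD, bind₁_smul_dirD, bind₁_smul_form, dirD_C_mul, dirD_C_mul]
  simp

/-! ### The equations through directional derivatives -/

/-- The second derivative `P(Z(t))''` along a 2-jet. -/
noncomputable def secondD (Z' Z'' : Fin 3 → ℂ) (p : MvPolynomial (Fin 3) ℂ) :
    MvPolynomial (Fin 3) ℂ :=
  dirD Z'' p + dirD Z' (dirD Z' p)

theorem eqns_zero (i : Fin 3) (x : Coord d → ℂ) :
    eqns d i x 0 = x (.l 0) ^ d + eval (homJet i x 0) (form (coeffs x)) := rfl

theorem eqns_one (i : Fin 3) (x : Coord d → ℂ) :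
    eqns d i x 1 = d * x (.l 0) ^ d * x (.l 1) +
      eval (homJet i x 0) (dirD (homJet i x 1) (form (coeffs x))) := by
  rw [dirD_apply]
  simp [eqns, mul_comm]

theorem eqns_two (i : Fin 3) (x : Coord d → ℂ) :
    eqns d i x 2 = d * x (.l 0) ^ d * x (.l 2) + d ^ 2 * x (.l 0) ^ d * x (.l 1) ^ 2 +
      eval (homJet i x 0) (secondD (homJet i x 1) (homJet i x 2) (form (coeffs x))) := by
  have h : ∀ p : MvPolynomial (Fin 3) ℂ, ∀ k, pderiv k (dirD (homJet i x 1) p) =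
      ∑ j, C (homJet i x 1 j) * pderiv k (pderiv j p) := fun p k => by
    rw [dirD_apply, map_sum]; simp
  simp only [secondD, dirD_apply _ (dirD _ _), h, map_add, ← add_assoc]
  rw [dirD_apply]
  simp only [eqns, map_sum, map_mul, eval_C, Finset.mul_sum, Matrix.cons_val]
  congr 1
  · congr 1
    exact Finset.sum_congr rfl fun _ _ => mul_comm _ _
  · refine Finset.sum_congr rfl fun _ _ => Finset.sum_congr rfl fun _ _ => by ring

/-! The differential of the equations -/

/-- The differential of `homJet i` in the direction `v`. -/
noncomputable def dJet (i : Fin 3) (v : Coord d → ℂ) (o : Fin 3) : Fin 3 → ℂ :=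
  Fin.insertNth (α := fun _ => ℂ) i 0 (fun k : Fin 2 => v (.w o k))

theorem homJet_self (i : Fin 3) (x : Coord d → ℂ) (o : Fin 3) :
    homJet i x o i = if o = 0 then 1 else 0 := by
  simp [homJet]

theorem homJet_succAbove (i : Fin 3) (x : Coord d → ℂ) (o : Fin 3) (k : Fin 2) :
    homJet i x o (i.succAbove k) = x (.w o k) := by
  simp [homJet]

theorem dJet_self (i : Fin 3) (v : Coord d → ℂ) (o : Fin 3) : dJet i v o i = 0 := by
  simp [dJet]

theorem dJet_succAbove (i : Fin 3) (v : Coord d → ℂ) (o : Fin 3) (k : Fin 2) :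
    dJet i v o (i.succAbove k) = v (.w o k) := by
  simp [dJet]

theorem homJet_add_smul (i : Fin 3) (x v : Coord d → ℂ) (s : ℂ) (o : Fin 3) :
    homJet i (x + s • v) o = homJet i x o + s • dJet i v o := by
  funext k
  rcases Fin.eq_self_or_eq_succAbove i k with rfl | ⟨k, rfl⟩
  · simp [homJet_self, dJet_self]
  · simp [homJet_succAbove, dJet_succAbove]

theorem differentiable_homJet (i o k : Fin 3) :
    Differentiable ℂ fun x : Coord d → ℂ => homJet i x o k := by
  rcases Fin.eq_self_or_eq_succAbove i k with rfl | ⟨k, rfl⟩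
  · simp [homJet_self]
  · simp only [homJet_succAbove]; fun_prop

theorem differentiable_eval_comp {E : Type*} [NormedAddCommGroup E] [NormedSpace ℂ E]
    {Z : E → Fin 3 → ℂ} (hZ : ∀ k, Differentiable ℂ fun x => Z x k)
    (p : MvPolynomial (Fin 3) ℂ) : Differentiable ℂ fun x => eval (Z x) p := by
  induction p using MvPolynomial.induction_on with
  | C a => simp
  | add p q hp hq => simpa using hp.fun_add hq
  | mul_X p k hp => simpa using hp.fun_mul (hZ k)

theorem differentiable_eval_form (i : Fin 3)
    (T : MvPolynomial (Fin 3) ℂ →ₗ[ℂ] MvPolynomial (Fin 3) ℂ) :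
    Differentiable ℂ fun x : Coord d → ℂ => eval (homJet i x 0) (T (form (coeffs x))) := by
  have h : ∀ x : Coord d → ℂ, eval (homJet i x 0) (T (form (coeffs x))) =
      ∑ α, x (.a α) * eval (homJet i x 0) (T (monomial (expo α) 1)) := fun x => by
    rw [form_eq_sum_monomial, map_sum, map_sum]
    refine Finset.sum_congr rfl fun α _ => ?_
    rw [← mul_one (coeffs x α), ← smul_eq_mul, ← smul_monomial, map_smul, smul_eval]
    rfl
  simp only [h]
  refine Differentiable.fun_sum fun α _ => ?_
  exact (by fun_prop : Differentiable ℂ fun x : Coord d → ℂ => x (.a α)).mul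
    (differentiable_eval_comp (differentiable_homJet i 0) _)

theorem differentiable_eqns (i : Fin 3) : Differentiable ℂ (eqns d i) := by
  rw [differentiable_pi]
  have h0 := differentiable_eval_form (d := d) i LinearMap.id
  have h1 := fun j => differentiable_eval_form (d := d) i (pderiv j).toLinearMap
  have h2 := fun j k =>
    differentiable_eval_form (d := d) i ((pderiv j).toLinearMap ∘ₗ (pderiv k).toLinearMap)
  have hl : ∀ c, Differentiable ℂ fun x : Coord d → ℂ => x c := fun c => by fun_prop
  have hJ := differentiable_homJet (d := d) i
  simp only [LinearMap.id_apply, LinearMap.comp_apply, Derivation.coeFn_coe] at h0 h1 h2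
  intro o
  fin_cases o
  · exact ((hl _).pow d).add h0
  · refine (((differentiable_const _).mul ((hl _).pow d)).mul (hl _)).add
      (Differentiable.fun_sum fun j _ => (h1 j).mul (hJ 1 j))
  · refine ((((((differentiable_const _).mul ((hl _).pow d)).mul (hl _)).add
      (((differentiable_const _).mul ((hl _).pow d)).mul ((hl _).pow 2)))).add
      (Differentiable.fun_sum fun j _ => (h1 j).mul (hJ 2 j))).add
      (Differentiable.fun_sum fun j _ => Differentiable.fun_sum fun k _ =>
        ((h2 j k).mul (hJ 1 j)).mul (hJ 1 k))

/-- The differential of the equations at `x` in the direction `v`. -/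
noncomputable def dEqns (i : Fin 3) (x v : Coord d → ℂ) : Fin 3 → ℂ :=
  let P := form (coeffs x)
  let Q := form (coeffs v)
  let Z := homJet i x
  let D := dJet i v
  let m := d * x (.l 0) ^ (d - 1) * v (.l 0)
  ![m + eval (Z 0) (dirD (D 0) P + Q),
    d * m * x (.l 1) + d * x (.l 0) ^ d * v (.l 1)
      + eval (Z 0) (dirD (D 0) (dirD (Z 1) P) + (dirD (D 1) P + dirD (Z 1) Q)),
    d * m * x (.l 2) + d * x (.l 0) ^ d * v (.l 2)
      + d ^ 2 * (m * x (.l 1) ^ 2 + x (.l 0) ^ d * (2 * x (.l 1) * v (.l 1)))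
      + eval (Z 0) (dirD (D 0) (secondD (Z 1) (Z 2) P)
        + (dirD (D 2) P + 2 * dirD (D 1) (dirD (Z 1) P) + secondD (Z 1) (Z 2) Q))]

theorem hasDerivAt_eval_add_smul (Z δ : Fin 3 → ℂ) (p : MvPolynomial (Fin 3) ℂ) :
    HasDerivAt (fun s : ℂ => eval (Z + s • δ) p) (eval Z (dirD δ p)) 0 := by
  induction p using MvPolynomial.induction_on with
  | C a => simpa using hasDerivAt_const (0 : ℂ) a
  | add p q hp hq => simpa using hp.fun_add hq
  | mul_X p k hp =>
    have h : HasDerivAt (fun s : ℂ => Z k + s * δ k) (δ k) 0 := by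
      simpa using ((hasDerivAt_id (0 : ℂ)).mul_const (δ k)).const_add (Z k)
    simpa [Derivation.leibniz, mul_comm, add_comm] using hp.fun_mul h

/-- On a line `x + s v` each equation contains an evaluation of a polynomial whose coefficients have
degree at most three in `s`: the term `dirD Z' (dirD Z' P)` is linear in `P` and quadratic in `Z'`.
Only the linear coefficient survives at `s = 0`. -/
theorem hasDerivAt_eval_cubic (Z δ : Fin 3 → ℂ) (p₀ p₁ p₂ p₃ : MvPolynomial (Fin 3) ℂ) :
    HasDerivAt (fun s : ℂ => eval (Z + s • δ) (p₀ + s • p₁ + s ^ 2 • p₂ + s ^ 3 • p₃))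
      (eval Z (dirD δ p₀ + p₁)) 0 := by
  have h0 := hasDerivAt_eval_add_smul Z δ p₀
  have h1 := (hasDerivAt_id' (0 : ℂ)).fun_mul (hasDerivAt_eval_add_smul Z δ p₁)
  have h2 := ((hasDerivAt_id' (0 : ℂ)).fun_pow 2).fun_mul (hasDerivAt_eval_add_smul Z δ p₂)
  have h3 := ((hasDerivAt_id' (0 : ℂ)).fun_pow 3).fun_mul (hasDerivAt_eval_add_smul Z δ p₃)
  simpa [smul_eval] using ((h0.fun_add h1).fun_add h2).fun_add h3

theorem form_coeffs_add_smul (x v : Coord d → ℂ) (s : ℂ) :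
    form (coeffs (x + s • v)) = form (coeffs x) + s • form (coeffs v) := by
  rw [← form_smul, ← form_add]; rfl

theorem hasDerivAt_eqns (i : Fin 3) (x v : Coord d → ℂ) :
    HasDerivAt (fun s : ℂ => eqns d i (x + s • v)) (dEqns i x v) 0 := by
  have hl : ∀ c, HasDerivAt (fun s : ℂ => x c + s * v c) (v c) 0 := fun c => by
    simpa using ((hasDerivAt_id (0 : ℂ)).mul_const (v c)).const_add (x c)
  have hm := (hl (.l 0)).pow d
  rw [hasDerivAt_pi]
  intro o
  fin_cases o
  · have h := hm.add (hasDerivAt_eval_cubic (homJet i x 0) (dJet i v 0) (form (coeffs x))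
      (form (coeffs v)) 0 0)
    simp only [smul_zero, add_zero] at h
    simp only [Fin.zero_eta, eqns_zero, homJet_add_smul, form_coeffs_add_smul, Pi.add_apply,
      Pi.smul_apply, smul_eq_mul]
    convert h using 1
    · rfl
    · simp [dEqns]
  · have h := ((hm.const_mul (d : ℂ)).mul (hl (.l 1))).add
      (hasDerivAt_eval_cubic (homJet i x 0) (dJet i v 0)
      (dirD (homJet i x 1) (form (coeffs x)))
      (dirD (dJet i v 1) (form (coeffs x)) + dirD (homJet i x 1) (form (coeffs v)))
      (dirD (dJet i v 1) (form (coeffs v))) 0)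
    simp only [Fin.mk_one, eqns_one, homJet_add_smul, form_coeffs_add_smul, Pi.add_apply,
      Pi.smul_apply, smul_eq_mul]
    convert h using 1
    · funext s
      simp only [Pi.add_apply, Pi.mul_apply, Pi.pow_apply]
      congr 2
      simp only [dirD_add, dirD_smul, Derivation.add_apply, Derivation.smul_apply, map_add,
        Derivation.map_smul]
      module
    · simp [dEqns]
  · have h := ((((hm.const_mul (d : ℂ)).mul (hl (.l 2))).add
      ((hm.const_mul ((d : ℂ) ^ 2)).mul ((hl (.l 1)).pow 2)))).add
      (hasDerivAt_eval_cubic (homJet i x 0) (dJet i v 0)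
      (secondD (homJet i x 1) (homJet i x 2) (form (coeffs x)))
      (dirD (dJet i v 2) (form (coeffs x)) +
        2 * dirD (dJet i v 1) (dirD (homJet i x 1) (form (coeffs x))) +
        secondD (homJet i x 1) (homJet i x 2) (form (coeffs v)))
      (dirD (dJet i v 2) (form (coeffs v)) +
        dirD (dJet i v 1) (dirD (dJet i v 1) (form (coeffs x))) +
        2 * dirD (dJet i v 1) (dirD (homJet i x 1) (form (coeffs v))))
      (dirD (dJet i v 1) (dirD (dJet i v 1) (form (coeffs v)))))
    simp only [Fin.reduceFinMk, eqns_two, homJet_add_smul, form_coeffs_add_smul, Pi.add_apply,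
      Pi.smul_apply, smul_eq_mul]
    convert h using 1
    · funext s
      simp only [Pi.add_apply, Pi.mul_apply, Pi.pow_apply]
      congr 2
      simp only [secondD, dirD_add, dirD_smul, Derivation.add_apply, Derivation.smul_apply,
        map_add, Derivation.map_smul, dirD_comm (homJet i x 1) (dJet i v 1)]
      simp only [two_mul]
      module
    · simp [dEqns]
      ring

theorem fderiv_eqns (i : Fin 3) (x v : Coord d → ℂ) :
    fderiv ℂ (eqns d i) x v = dEqns i x v := by
  rw [← (differentiable_eqns i x).lineDeriv_eq_fderiv, lineDeriv]
  exact (hasDerivAt_eqns i x v).deriv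

theorem mem_tangentSpace_iff (i : Fin 3) (x v : Coord d → ℂ) :
    v ∈ tangentSpace i x ↔ dEqns i x v = 0 := by
  rw [tangentSpace, LinearMap.mem_ker, ← fderiv_eqns]
  rfl

/-! Polynomial functions of the chart coordinates -/

/-- The function `f` of the chart coordinates is polynomial, of degree at most `e` in the
coefficients `a_α`. -/
def IsPoly (e : ℕ) (f : (Coord d → ℂ) → ℂ) : Prop :=
  ∃ p : MvPolynomial (Coord d) ℂ, (∀ x, eval x p = f x) ∧
    ∀ m ∈ p.support, ∑ α, m (.a α) ≤ e

namespace IsPoly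

variable {e e' : ℕ} {f g : (Coord d → ℂ) → ℂ}

theorem const (c : ℂ) : IsPoly (d := d) e fun _ => c := by
  classical
  refine ⟨C c, by simp, fun m hm => ?_⟩
  rw [mem_support_iff, coeff_C] at hm
  obtain rfl : 0 = m := by by_contra h; simp [h] at hm
  simp

theorem mono (hf : IsPoly e f) (h : e ≤ e') : IsPoly e' f := by
  obtain ⟨p, h1, h2⟩ := hf
  exact ⟨p, h1, fun m hm => (h2 m hm).trans h⟩

theorem add (hf : IsPoly e f) (hg : IsPoly e g) : IsPoly e fun x => f x + g x := by
  classical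
  obtain ⟨p, h1, h2⟩ := hf
  obtain ⟨q, h3, h4⟩ := hg
  refine ⟨p + q, by simp [h1, h3], fun m hm => ?_⟩
  rcases Finset.mem_union.1 (support_add hm) with h | h
  exacts [h2 m h, h4 m h]

theorem mul (hf : IsPoly e f) (hg : IsPoly e' g) : IsPoly (e + e') fun x => f x * g x := by
  classical
  obtain ⟨p, h1, h2⟩ := hf
  obtain ⟨q, h3, h4⟩ := hg
  refine ⟨p * q, by simp [h1, h3], fun m hm => ?_⟩
  obtain ⟨a, ha, b, hb, rfl⟩ := Finset.mem_add.1 (support_mul _ _ hm)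
  simpa [Finset.sum_add_distrib] using add_le_add (h2 a ha) (h4 b hb)

theorem zero_mul (hf : IsPoly 0 f) (hg : IsPoly e g) : IsPoly e fun x => f x * g x := by
  simpa using hf.mul hg

theorem const_mul (c : ℂ) (hg : IsPoly e g) : IsPoly e fun x => c * g x := (const c).zero_mul hg

theorem sub (hf : IsPoly e f) (hg : IsPoly e g) : IsPoly e fun x => f x - g x := by
  simpa [sub_eq_add_neg] using hf.add (hg.const_mul (-1))

theorem neg (hf : IsPoly e f) : IsPoly e fun x => -f x := by
  simpa using hf.const_mul (-1)

theorem pow (hf : IsPoly 0 f) (n : ℕ) : IsPoly 0 fun x => f x ^ n := by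
  induction n with
  | zero => simpa using const 1
  | succ n ih => simpa [pow_succ] using ih.zero_mul hf

theorem sum {ι : Type*} (s : Finset ι) {F : ι → (Coord d → ℂ) → ℂ} (h : ∀ i, IsPoly e (F i)) :
    IsPoly e fun x => ∑ i ∈ s, F i x := by
  classical
  induction s using Finset.induction_on with
  | empty => simpa using const 0
  | insert i s hi ih => simpa [Finset.sum_insert hi] using (h i).add ih

theorem coord (c : Coord d) (hc : ∀ α, c ≠ .a α) : IsPoly 0 fun x : Coord d → ℂ => x c := by
  classical
  refine ⟨X c, by simp, fun m hm => ?_⟩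
  rw [support_X, Finset.mem_singleton] at hm
  subst hm
  simp [hc]

theorem coord_a (α : Idx d) : IsPoly 1 fun x : Coord d → ℂ => x (.a α) := by
  classical
  refine ⟨X (.a α), by simp, fun m hm => ?_⟩
  rw [support_X, Finset.mem_singleton] at hm
  subst hm
  simp [Finsupp.single_apply]

theorem homJet (i o k : Fin 3) : IsPoly 0 fun x : Coord d → ℂ => homJet i x o k := by
  rcases Fin.eq_self_or_eq_succAbove i k with rfl | ⟨k, rfl⟩
  · simpa [homJet_self] using const _
  · simpa [homJet_succAbove] using coord (.w o k) (by simp)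

end IsPoly

/-! Sections of twists of the tangent sheaf, as polynomial functions -/

/-- The vector fields `V i` in the charts form a global section of the twist by `𝒪(c)` and
`𝒪(e)`. -/
structure IsSection (d c e : ℕ) (V : Fin 3 → (Coord d → ℂ) → Coord d → ℂ) : Prop where
  poly : ∀ i k, IsPoly e fun x => V i x k
  tangent : ∀ i, ∀ x ∈ jetChart d i, V i x ∈ tangentSpace i x
  compat : ∀ i j, ∀ x ∈ jetChart d i, homJet i x 0 j ≠ 0 →
    fderiv ℂ (transition d i j) x (V i x) = homJet i x 0 j ^ c • V j (transition d i j x)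

namespace IsSection

variable {c e : ℕ} {V W : Fin 3 → (Coord d → ℂ) → Coord d → ℂ}

theorem exists_globalSection (h : IsSection d c e V) :
    ∃ s : GlobalSection d c e, ∀ i x, s.value i x = V i x := by
  choose p hp hdeg using h.poly
  have hp' : ∀ i x, (fun k => eval x (p i k)) = V i x := fun i x => funext fun k => hp i k x
  exact ⟨⟨p, fun i x hx => by rw [hp']; exact h.tangent i x hx,
    fun i j x hx hj => by rw [hp', hp']; exact h.compat i j x hx hj, hdeg⟩, hp'⟩

theorem zero : IsSection d c e fun _ _ => 0 where
  poly _ _ := IsPoly.const 0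
  tangent _ _ _ := zero_mem _
  compat _ _ _ _ _ := by simp

theorem add (hV : IsSection d c e V) (hW : IsSection d c e W) :
    IsSection d c e fun i x => V i x + W i x where
  poly i k := (hV.poly i k).add (hW.poly i k)
  tangent i x hx := add_mem (hV.tangent i x hx) (hW.tangent i x hx)
  compat i j x hx hj := by
    rw [map_add, hV.compat i j x hx hj, hW.compat i j x hx hj, smul_add]

theorem smul (t : ℂ) (hV : IsSection d c e V) : IsSection d c e fun i x => t • V i x where
  poly i k := (hV.poly i k).const_mul t
  tangent i x hx := Submodule.smul_mem _ _ (hV.tangent i x hx)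
  compat i j x hx hj := by rw [map_smul, hV.compat i j x hx hj, smul_comm]

/-- The homogeneous coordinate `Z_l` is a section of `𝒪(1)`, equal to `homJet i x 0 l` in the chart
`i`. With `l = i` it raises the twist without changing the value in that chart. -/
theorem mul_pow (hV : IsSection d c e V) (l : Fin 3) (n : ℕ) :
    IsSection d (c + n) e fun i x => homJet i x 0 l ^ n • V i x where
  poly i k := ((IsPoly.homJet i 0 l).pow n).zero_mul (hV.poly i k)
  tangent i x hx := Submodule.smul_mem _ _ (hV.tangent i x hx)
  compat i j x hx hj := by
    rw [map_smul, hV.compat i j x hx hj, homJet_transition i j x hj, smul_smul, smul_smul]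
    congr 1
    rw [div_pow, pow_add]
    field_simp

end IsSection

/-- The values at a point of the sections of the twist by `𝒪(c)` and `𝒪(e)`. -/
def sectionValues (c e : ℕ) (i : Fin 3) (x : Coord d → ℂ) : Submodule ℂ (Coord d → ℂ) where
  carrier := {v | ∃ V, IsSection d c e V ∧ V i x = v}
  zero_mem' := ⟨_, IsSection.zero, rfl⟩
  add_mem' := by
    rintro _ _ ⟨V, hV, rfl⟩ ⟨W, hW, rfl⟩
    exact ⟨_, hV.add hW, rfl⟩
  smul_mem' := by
    rintro t _ ⟨V, hV, rfl⟩
    exact ⟨_, hV.smul t, rfl⟩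

/-! The differential of the change of coordinates -/

/-- The product of two 2-jets. -/
noncomputable def mulJet (f g : Fin 3 → ℂ) : Fin 3 → ℂ :=
  ![f 0 * g 0, f 0 * g 1 + f 1 * g 0, f 0 * g 2 + 2 * f 1 * g 1 + f 2 * g 0]

/-- The differential of `quotJet` at `(f, g)` in the direction `(δf, δg)`. -/
noncomputable def dQuotJet (f g δf δg : Fin 3 → ℂ) : Fin 3 → ℂ :=
  quotJet δf g - mulJet (quotJet δg g) (quotJet f g)

/-- The differential of `quotLogJet` at `(f, g)` in the direction `(δf, δg)`. -/
noncomputable def dQuotLogJet (f g δf δg : Fin 3 → ℂ) : Fin 3 → ℂ :=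
  ![δf 0 / g 0 - f 0 / g 0 * quotJet δg g 0, δf 1 - quotJet δg g 1, δf 2 - quotJet δg g 2]

/-- The differential of the change of coordinates at `x` in the direction `v`. -/
noncomputable def dTransition (i j : Fin 3) (x v : Coord d → ℂ) : Coord d → ℂ
  | .w o k => dQuotJet (fun o' => homJet i x o' (j.succAbove k)) (fun o' => homJet i x o' j)
      (fun o' => dJet i v o' (j.succAbove k)) (fun o' => dJet i v o' j) o
  | .l o => dQuotLogJet (fun o' => x (.l o')) (fun o' => homJet i x o' j)
      (fun o' => v (.l o')) (fun o' => dJet i v o' j) o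
  | .a α => v (.a α)

theorem differentiableAt_quotJet {E : Type*} [NormedAddCommGroup E] [NormedSpace ℂ E]
    {f g : E → Fin 3 → ℂ} {x : E} (hf : ∀ o, DifferentiableAt ℂ (fun y => f y o) x)
    (hg : ∀ o, DifferentiableAt ℂ (fun y => g y o) x) (h : g x 0 ≠ 0) (o : Fin 3) :
    DifferentiableAt ℂ (fun y => quotJet (f y) (g y) o) x := by
  have f0 := hf 0
  have f1 := hf 1
  have f2 := hf 2
  have g0 := hg 0
  have g1 := hg 1
  have g2 := hg 2
  have h2 := pow_ne_zero 2 h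
  have h3 := pow_ne_zero 3 h
  fin_cases o <;> simp only [quotJet, Fin.zero_eta, Fin.mk_one, Fin.reduceFinMk,
    Matrix.cons_val] <;> fun_prop (disch := assumption)

theorem differentiableAt_quotLogJet {E : Type*} [NormedAddCommGroup E] [NormedSpace ℂ E]
    {f g : E → Fin 3 → ℂ} {x : E} (hf : ∀ o, DifferentiableAt ℂ (fun y => f y o) x)
    (hg : ∀ o, DifferentiableAt ℂ (fun y => g y o) x) (h : g x 0 ≠ 0) (o : Fin 3) :
    DifferentiableAt ℂ (fun y => quotLogJet (f y) (g y) o) x := by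
  have f0 := hf 0
  have f1 := hf 1
  have f2 := hf 2
  have g0 := hg 0
  have g1 := hg 1
  have g2 := hg 2
  fin_cases o <;> simp only [quotLogJet, Fin.zero_eta, Fin.mk_one, Fin.reduceFinMk,
    Matrix.cons_val] <;> fun_prop (disch := assumption)

theorem differentiableAt_transition (i j : Fin 3) (x : Coord d → ℂ) (h : homJet i x 0 j ≠ 0) :
    DifferentiableAt ℂ (transition d i j) x := by
  rw [differentiableAt_pi]
  have hJ := fun o k => differentiable_homJet (d := d) i o k x
  intro c
  cases c with
  | w o k => exact differentiableAt_quotJet (fun o => hJ o _) (fun o => hJ o _) h o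
  | l o => exact differentiableAt_quotLogJet (f := fun y o' => y (.l o')) (fun o => by fun_prop) (fun o => hJ o _) h o
  | a α => simp only [transition]; fun_prop

theorem hasDerivAt_quotJet (f g δf δg : Fin 3 → ℂ) (h : g 0 ≠ 0) (o : Fin 3) :
    HasDerivAt (fun s : ℂ => quotJet (f + s • δf) (g + s • δg) o) (dQuotJet f g δf δg o) 0 := by
  have hl : ∀ (f δ : Fin 3 → ℂ) c, HasDerivAt (fun s : ℂ => f c + s * δ c) (δ c) 0 :=
    fun f δ c => by simpa using ((hasDerivAt_id (0 : ℂ)).mul_const (δ c)).const_add (f c)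
  have hf := hl f δf
  have hg := hl g δg
  have h0 : g 0 + 0 * δg 0 ≠ 0 := by simpa using h
  have h2 := pow_ne_zero 2 h0
  have h3 := pow_ne_zero 3 h0
  fin_cases o <;> simp only [quotJet, Fin.zero_eta, Fin.mk_one, Fin.reduceFinMk,
    Matrix.cons_val, Pi.add_apply, Pi.smul_apply, smul_eq_mul]
  · refine ((hf 0).fun_div (hg 0) h0).congr_deriv ?_
    simp [dQuotJet, mulJet, quotJet]
    field_simp
  · refine (((hf 1).fun_div (hg 0) h0).fun_sub
      (((hf 0).fun_mul (hg 1)).fun_div ((hg 0).fun_pow 2) h2)).congr_deriv ?_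
    simp [dQuotJet, mulJet, quotJet]
    field_simp
    ring
  · refine (((((hf 2).fun_div (hg 0) h0).fun_sub
      ((((hf 1).const_mul 2).fun_mul (hg 1)).fun_div ((hg 0).fun_pow 2) h2)).fun_sub
      (((hf 0).fun_mul (hg 2)).fun_div ((hg 0).fun_pow 2) h2)).fun_add
      ((((hf 0).const_mul 2).fun_mul ((hg 1).fun_pow 2)).fun_div
        ((hg 0).fun_pow 3) h3)).congr_deriv ?_
    simp [dQuotJet, mulJet, quotJet]
    field_simp
    ring

theorem hasDerivAt_quotLogJet (f g δf δg : Fin 3 → ℂ) (h : g 0 ≠ 0) (o : Fin 3) :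
    HasDerivAt (fun s : ℂ => quotLogJet (f + s • δf) (g + s • δg) o)
      (dQuotLogJet f g δf δg o) 0 := by
  have hl : ∀ (f δ : Fin 3 → ℂ) c, HasDerivAt (fun s : ℂ => f c + s * δ c) (δ c) 0 :=
    fun f δ c => by simpa using ((hasDerivAt_id (0 : ℂ)).mul_const (δ c)).const_add (f c)
  have hf := hl f δf
  have hg := hl g δg
  have h0 : g 0 + 0 * δg 0 ≠ 0 := by simpa using h
  fin_cases o <;> simp only [quotLogJet, Fin.zero_eta, Fin.mk_one, Fin.reduceFinMk,
    Matrix.cons_val, Pi.add_apply, Pi.smul_apply, smul_eq_mul]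
  · refine ((hf 0).fun_div (hg 0) h0).congr_deriv ?_
    simp [dQuotLogJet, quotJet]
    field_simp
  · refine ((hf 1).fun_sub ((hg 1).fun_div (hg 0) h0)).congr_deriv ?_
    simp [dQuotLogJet, quotJet]
    field_simp
  · refine ((hf 2).fun_sub (((hg 2).fun_div (hg 0) h0).fun_sub
      (((hg 1).fun_div (hg 0) h0).fun_pow 2))).congr_deriv ?_
    simp [dQuotLogJet, quotJet]
    field_simp
    ring

theorem fderiv_transition (i j : Fin 3) (x v : Coord d → ℂ) (h : homJet i x 0 j ≠ 0) :
    fderiv ℂ (transition d i j) x v = dTransition i j x v := by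
  rw [← (differentiableAt_transition i j x h).lineDeriv_eq_fderiv, lineDeriv]
  refine HasDerivAt.deriv ?_
  rw [hasDerivAt_pi]
  have hJ : ∀ (s : ℂ) k, (fun o' => homJet i (x + s • v) o' k) =
      (fun o' => homJet i x o' k) + s • fun o' => dJet i v o' k := fun s k => by
    funext o; simp [homJet_add_smul]
  intro c
  cases c with
  | w o k =>
    simp only [transition, hJ]
    exact hasDerivAt_quotJet _ _ _ _ h o
  | l o =>
    simp only [transition, hJ]
    exact hasDerivAt_quotLogJet (fun o' => x (.l o')) _ (fun o' => v (.l o')) _ h o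
  | a α =>
    simpa [transition, dTransition] using
      ((hasDerivAt_id (0 : ℂ)).mul_const (v (.a α))).const_add (x (.a α))

/-- A change of chart divides the whole lifted jet by the jet of `Z_j`; for `k = j` the quotient is
the jet of the constant 1. Equivariance under such division is therefore all that gluing requires.
-/
theorem homJet_transition_eq_quotJet (i j : Fin 3) (x : Coord d → ℂ) (h : homJet i x 0 j ≠ 0)
    (o k : Fin 3) :
    homJet j (transition d i j x) o k =
      quotJet (fun o' => homJet i x o' k) (fun o' => homJet i x o' j) o := by
  rcases Fin.eq_self_or_eq_succAbove j k with rfl | ⟨k, rfl⟩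
  · fin_cases o <;> simp [homJet_self, quotJet, h]
    · field_simp
      ring
    · field_simp
      ring
  · rw [homJet_succAbove]; rfl

/-! Infinitesimal linear transformations -/

/-- The infinitesimal rescaling that keeps `Z_i = 1` when the jet moves by `M`. -/
noncomputable def scaleJet (M : Matrix (Fin 3) (Fin 3) ℂ) (i : Fin 3) (x : Coord d → ℂ) :
    Fin 3 → ℂ :=
  fun o => -M.mulVec (homJet i x o) i

/-- The vector field on the log jet space induced by the action of `M ∈ 𝔤𝔩₃` on `ℙ³` and on the
parameters, fixing `Z₃`. -/
noncomputable def glField (M : Matrix (Fin 3) (Fin 3) ℂ) (i : Fin 3) (x : Coord d → ℂ) :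
    Coord d → ℂ
  | .w o k => M.mulVec (homJet i x o) (i.succAbove k) +
      mulJet (scaleJet M i x) (fun o' => homJet i x o' (i.succAbove k)) o
  | .l o => ![scaleJet M i x 0 * x (.l 0), scaleJet M i x 1, scaleJet M i x 2] o
  | .a α => -coeffVec d (linD M (form (coeffs x))) α

/-- The formula persists for `k = i`: `scaleJet` is chosen so that both terms cancel there. -/
theorem dJet_glField (M : Matrix (Fin 3) (Fin 3) ℂ) (i : Fin 3) (x : Coord d → ℂ) (o k : Fin 3) :
    dJet i (glField M i x) o k = M.mulVec (homJet i x o) k +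
      mulJet (scaleJet M i x) (fun o' => homJet i x o' k) o := by
  rcases Fin.eq_self_or_eq_succAbove i k with rfl | ⟨k, rfl⟩
  · fin_cases o <;> simp [dJet_self, homJet_self, mulJet, scaleJet]
  · rw [dJet_succAbove]; rfl

theorem linForm_isHomogeneous (c : Fin 3 → ℂ) : (linForm c).IsHomogeneous 1 :=
  IsHomogeneous.sum _ _ _ fun k _ => isHomogeneous_C_mul_X _ k

theorem linD_isHomogeneous (M : Matrix (Fin 3) (Fin 3) ℂ) {p : MvPolynomial (Fin 3) ℂ}
    (hd : 1 ≤ d) (hp : p.IsHomogeneous d) : (linD M p).IsHomogeneous d := by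
  rw [linD_apply]
  refine IsHomogeneous.sum _ _ _ fun k _ => ?_
  have h := (linForm_isHomogeneous (M k)).mul (hp.pderiv (i := k))
  rwa [Nat.add_sub_cancel' hd] at h

theorem form_coeffs_glField (hd : 1 ≤ d) (M : Matrix (Fin 3) (Fin 3) ℂ) (i : Fin 3)
    (x : Coord d → ℂ) :
    form (coeffs (glField M i x)) = -linD M (form (coeffs x)) := by
  rw [show coeffs (glField M i x) = (-1 : ℂ) • coeffVec d (linD M (form (coeffs x))) by
    funext α; simp [coeffs, glField], form_smul,
    form_coeffVec _ (linD_isHomogeneous M hd (form_isHomogeneous _))]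
  simp

/-- The motion by `M` cancels against the motion `-linD M` of the form. What remains is the
rescaling by the jet `γ` of `scaleJet`, under which equations homogeneous of degree `d` vary by `d`
times the jet product of `γ` with the equations themselves, hence by zero on the jet space. -/
theorem dEqns_glField (hd : 1 ≤ d) (M : Matrix (Fin 3) (Fin 3) ℂ) (i : Fin 3) (x : Coord d → ℂ)
    (hx : eqns d i x = 0) : dEqns i x (glField M i x) = 0 := by
  have hJ : ∀ o, dJet i (glField M i x) o = M.mulVec (homJet i x o) +
      ![scaleJet M i x 0 • homJet i x 0,
        scaleJet M i x 0 • homJet i x 1 + scaleJet M i x 1 • homJet i x 0,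
        scaleJet M i x 0 • homJet i x 2 + (2 * scaleJet M i x 1) • homJet i x 1 +
          scaleJet M i x 2 • homJet i x 0] o := fun o => by
    funext k
    rw [dJet_glField]
    fin_cases o <;> simp [mulJet]
  have hl0 : glField M i x (.l 0) = scaleJet M i x 0 * x (.l 0) := rfl
  have hl1 : glField M i x (.l 1) = scaleJet M i x 1 := rfl
  have hl2 : glField M i x (.l 2) = scaleJet M i x 2 := rfl
  have e0 := congrFun hx 0
  have e1 := congrFun hx 1
  have e2 := congrFun hx 2
  simp only [eqns_zero, eqns_one, eqns_two, secondD, Pi.zero_apply, map_add] at e0 e1 e2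
  have hP := form_isHomogeneous (coeffs x)
  have E0 := eval_dirD_self (homJet i x 0) _ hP
  have E1 := fun u => eval_dirD_dirD_self (homJet i x 0) u _ hP
  have E2 := fun u => eval_dirD_dirD_dirD_self (homJet i x 0) u _ hP
  have hpow : x (.l 0) ^ (d - 1) * x (.l 0) = x (.l 0) ^ d := by
    rw [← pow_succ, Nat.sub_add_cancel hd]
  simp only [dEqns, form_coeffs_glField hd, hJ, hl0, hl1, hl2, secondD]
  set P := form (coeffs x)
  set Z := homJet i x
  funext o
  fin_cases o <;> simp only [Fin.zero_eta, Fin.mk_one, Fin.reduceFinMk, Matrix.cons_val,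
    Pi.zero_apply, dirD_add, dirD_smul, Derivation.add_apply, Derivation.smul_apply, map_add,
    map_neg, map_mul, map_ofNat, smul_eval, dirD_linD, eval_linD, E0, E1, E2]
  · linear_combination (d * scaleJet M i x 0) * e0 + d * scaleJet M i x 0 * hpow
  · linear_combination (d * scaleJet M i x 0) * e1 + d * scaleJet M i x 1 * e0 +
      d ^ 2 * scaleJet M i x 0 * x (.l 1) * hpow
  · rw [dirD_comm (Z 1) (M.mulVec (Z 1))]
    linear_combination (d * scaleJet M i x 0) * e2 + 2 * d * scaleJet M i x 1 * e1 +
      d * scaleJet M i x 2 * e0 +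
      (d ^ 2 * scaleJet M i x 0 * x (.l 2) + d ^ 3 * scaleJet M i x 0 * x (.l 1) ^ 2) * hpow

theorem isPoly_coeffVec_map (T : MvPolynomial (Fin 3) ℂ →ₗ[ℂ] MvPolynomial (Fin 3) ℂ)
    (α : Idx d) : IsPoly 1 fun x : Coord d → ℂ => coeffVec d (T (form (coeffs x))) α := by
  have h : ∀ x : Coord d → ℂ, coeffVec d (T (form (coeffs x))) α =
      ∑ β, coeffVec d (T (monomial (expo β) 1)) α * x (.a β) := fun x => by
    rw [form_eq_sum_monomial, map_sum, map_sum, Finset.sum_apply]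
    refine Finset.sum_congr rfl fun β _ => ?_
    rw [← mul_one (coeffs x β), ← smul_eq_mul, ← smul_monomial, map_smul, map_smul, mul_comm]
    rfl
  simp only [h]
  exact IsPoly.sum _ fun β => (IsPoly.coord_a β).const_mul _

theorem IsPoly.mulVec (M : Matrix (Fin 3) (Fin 3) ℂ) (i o k : Fin 3) :
    IsPoly 0 fun x : Coord d → ℂ => M.mulVec (LogJets.homJet i x o) k := by
  simp only [Matrix.mulVec, dotProduct]
  exact IsPoly.sum _ fun l => (IsPoly.homJet i o l).const_mul (M k l)

theorem IsPoly.mulJet {f g : (Coord d → ℂ) → Fin 3 → ℂ} (hf : ∀ o, IsPoly 0 fun x => f x o)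
    (hg : ∀ o, IsPoly 0 fun x => g x o) (o : Fin 3) :
    IsPoly 0 fun x => mulJet (f x) (g x) o := by
  fin_cases o
  · exact (hf 0).zero_mul (hg 0)
  · exact ((hf 0).zero_mul (hg 1)).add ((hf 1).zero_mul (hg 0))
  · exact (((hf 0).zero_mul (hg 2)).add (((hf 1).const_mul 2).zero_mul (hg 1))).add
      ((hf 2).zero_mul (hg 0))

theorem isPoly_glField (M : Matrix (Fin 3) (Fin 3) ℂ) (i : Fin 3) (c : Coord d) :
    IsPoly 1 fun x => glField M i x c := by
  have hs : ∀ o, IsPoly 0 fun x : Coord d → ℂ => scaleJet M i x o := fun o =>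
    (IsPoly.mulVec M i o i).neg
  cases c with
  | w o k =>
    exact ((IsPoly.mulVec M i o _).add
      (IsPoly.mulJet hs (fun o => IsPoly.homJet i o _) o)).mono zero_le_one
  | l o =>
    fin_cases o
    · exact ((hs 0).zero_mul (IsPoly.coord (.l 0) (by simp))).mono zero_le_one
    · exact (hs 1).mono zero_le_one
    · exact (hs 2).mono zero_le_one
  | a α => exact (isPoly_coeffVec_map (linD M).toLinearMap α).neg

theorem mulVec_quotJet (M : Matrix (Fin 3) (Fin 3) ℂ) (J : Fin 3 → Fin 3 → ℂ) (g : Fin 3 → ℂ)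
    (o k : Fin 3) :
    M.mulVec (fun k' => quotJet (fun o' => J o' k') g o) k =
      quotJet (fun o' => M.mulVec (J o') k) g o := by
  fin_cases o <;> simp [Matrix.mulVec, dotProduct, Fin.sum_univ_three, quotJet] <;> ring

/-- A common rescaling `γ` of numerator and denominator drops out of the quotient. The term left
over is the rescaling that normalises the denominator, which is the one used in the target chart. -/
theorem dQuotJet_add_mulJet (f g γ mf mg : Fin 3 → ℂ) (h : g 0 ≠ 0) :
    dQuotJet f g (mf + mulJet γ f) (mg + mulJet γ g) =
      quotJet mf g + mulJet (-quotJet mg g) (quotJet f g) := by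
  funext o
  fin_cases o <;> simp [dQuotJet, quotJet, mulJet] <;> field_simp <;> ring

theorem dQuotLogJet_add_mulJet (f g γ mg : Fin 3 → ℂ) (h : g 0 ≠ 0) :
    dQuotLogJet f g ![γ 0 * f 0, γ 1, γ 2] (mg + mulJet γ g) =
      ![-quotJet mg g 0 * (f 0 / g 0), -quotJet mg g 1, -quotJet mg g 2] := by
  funext o
  fin_cases o <;> simp [dQuotLogJet, quotJet, mulJet] <;> field_simp <;> ring

theorem dTransition_glField (M : Matrix (Fin 3) (Fin 3) ℂ) (i j : Fin 3) (x : Coord d → ℂ)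
    (h : homJet i x 0 j ≠ 0) :
    dTransition i j x (glField M i x) = glField M j (transition d i j x) := by
  have hm : ∀ o k, M.mulVec (homJet j (transition d i j x) o) k =
      quotJet (fun o' => M.mulVec (homJet i x o') k) (fun o' => homJet i x o' j) o := fun o k => by
    rw [← mulVec_quotJet]
    congr 1
    funext k'
    exact homJet_transition_eq_quotJet i j x h o k'
  have hs : scaleJet M j (transition d i j x) =
      -quotJet (fun o' => M.mulVec (homJet i x o') j) (fun o' => homJet i x o' j) := by
    funext o
    simp [scaleJet, hm]
  have hD : ∀ k, (fun o => dJet i (glField M i x) o k) =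
      (fun o => M.mulVec (homJet i x o) k) +
        mulJet (scaleJet M i x) (fun o' => homJet i x o' k) := fun k => by
    funext o
    exact dJet_glField M i x o k
  funext c
  cases c with
  | w o k =>
    simp only [dTransition, hD, glField, hm, hs, homJet_transition_eq_quotJet i j x h]
    rw [dQuotJet_add_mulJet _ _ _ _ _ h]
    rfl
  | l o =>
    simp only [dTransition, hD, glField, hs]
    exact congrFun (dQuotLogJet_add_mulJet (fun o' => x (.l o')) _ _ _ h) o
  | a α => rfl

theorem isSection_glField (hd : 1 ≤ d) (M : Matrix (Fin 3) (Fin 3) ℂ) :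
    IsSection d 0 1 (glField M) where
  poly := isPoly_glField M
  tangent i x hx := (mem_tangentSpace_iff _ _ _).2 (dEqns_glField hd M i x hx.2)
  compat i j x _ hj := by
    rw [fderiv_transition i j x _ hj, dTransition_glField M i j x hj, pow_zero, one_smul]

/-! Vector fields in the direction of the parameters -/

/-- The vector field that moves only the parameters `a_α`. -/
noncomputable def paramField (b : Idx d → ℂ) : Coord d → ℂ
  | .w _ _ => 0
  | .l _ => 0
  | .a α => b α

theorem dJet_paramField (i : Fin 3) (b : Idx d → ℂ) (o : Fin 3) :
    dJet i (paramField b) o = 0 := by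
  funext k
  rcases Fin.eq_self_or_eq_succAbove i k with rfl | ⟨k, rfl⟩
  · simp [dJet_self]
  · simp [dJet_succAbove, paramField]

/-- The equations are affine in the `a_α`, so tangency means that the 2-jet of `form b` along the
given jet is zero. -/
theorem dEqns_paramField (i : Fin 3) (x : Coord d → ℂ) (b : Idx d → ℂ) :
    dEqns i x (paramField b) = ![eval (homJet i x 0) (form b),
      eval (homJet i x 0) (dirD (homJet i x 1) (form b)),
      eval (homJet i x 0) (secondD (homJet i x 1) (homJet i x 2) (form b))] := by
  have hb : coeffs (paramField b) = b := rfl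
  have hl : ∀ o, paramField b (.l o) = 0 := fun _ => rfl
  simp [dEqns, dJet_paramField, hb, hl, dirD_zero]

theorem dTransition_paramField (i j : Fin 3) (x : Coord d → ℂ) (b : Idx d → ℂ) :
    dTransition i j x (paramField b) = paramField b := by
  funext c
  cases c with
  | w o k => fin_cases o <;> simp [dTransition, dJet_paramField, dQuotJet, quotJet, mulJet,
      paramField]
  | l o => fin_cases o <;> simp [dTransition, dJet_paramField, dQuotLogJet, quotJet, paramField]
  | a α => rfl

/-- The three `kill` hypotheses are tangency, and homogeneity of weight `c` under division by a jet
`g` is the gluing condition for `𝒪(c)`. The parameters themselves do not change between charts. -/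
theorem isSection_paramField {c : ℕ} (Q : (Fin 3 → Fin 3 → ℂ) → MvPolynomial (Fin 3) ℂ)
    (hom : ∀ J, (Q J).IsHomogeneous d)
    (poly : ∀ i α, IsPoly (d := d) 0 fun x => coeff α (Q (homJet i x)))
    (kill₀ : ∀ J, eval (J 0) (Q J) = 0)
    (kill₁ : ∀ J, eval (J 0) (dirD (J 1) (Q J)) = 0)
    (kill₂ : ∀ J, eval (J 0) (secondD (J 1) (J 2) (Q J)) = 0)
    (equivariant : ∀ J g, g 0 ≠ 0 →
      Q J = C (g 0 ^ c) * Q fun o k => quotJet (fun o' => J o' k) g o) :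
    IsSection d c 1 fun i x => paramField (coeffVec d (Q (homJet i x))) where
  poly i k := by
    cases k with
    | w o k => exact IsPoly.const 0
    | l o => exact IsPoly.const 0
    | a α => exact (poly i _).mono zero_le_one
  tangent i x _ := by
    rw [mem_tangentSpace_iff, dEqns_paramField, form_coeffVec _ (hom _), kill₀, kill₁, kill₂]
    simp
  compat i j x _ hj := by
    rw [fderiv_transition i j x _ hj, dTransition_paramField]
    have h : homJet j (transition d i j x) =
        fun o k => quotJet (fun o' => homJet i x o' k) (fun o' => homJet i x o' j) o := by
      funext o k
      exact homJet_transition_eq_quotJet i j x hj o k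
    rw [h, equivariant (homJet i x) (fun o' => homJet i x o' j) hj, ← smul_eq_C_mul, map_smul]
    funext c
    cases c <;> simp [paramField]

/-! Parameter fields along forms vanishing on the jet -/

/-- The linear form `Z_i X_b - Z_b X_i`, which vanishes at `Z`. -/
noncomputable def vanForm (i b : Fin 3) (J : Fin 3 → Fin 3 → ℂ) : MvPolynomial (Fin 3) ℂ :=
  C (J 0 i) * X b - C (J 0 b) * X i

/-- The derivative along the jet of `Z_i X_b - Z_b X_i` at `Z`. -/
def vanDeriv (i b : Fin 3) (J : Fin 3 → Fin 3 → ℂ) : ℂ := J 0 i * J 1 b - J 0 b * J 1 i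

/-- The cross product `Z × Z'`. -/
def jetCross (J : Fin 3 → Fin 3 → ℂ) : Fin 3 → ℂ :=
  ![J 0 1 * J 1 2 - J 0 2 * J 1 1, J 0 2 * J 1 0 - J 0 0 * J 1 2, J 0 0 * J 1 1 - J 0 1 * J 1 0]

/-- The determinant `det (Z, Z', Z'')`. -/
def jetDet (J : Fin 3 → Fin 3 → ℂ) : ℂ := ∑ k, jetCross J k * J 2 k

theorem eval_vanForm (i b : Fin 3) (J : Fin 3 → Fin 3 → ℂ) : eval (J 0) (vanForm i b J) = 0 := by
  simp [vanForm]; ring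

theorem dirD_vanForm (i b : Fin 3) (J : Fin 3 → Fin 3 → ℂ) (u : Fin 3 → ℂ) :
    dirD u (vanForm i b J) = C (J 0 i * u b - J 0 b * u i) := by
  simp only [vanForm, map_sub, dirD_C_mul, dirD_X, map_mul]

theorem eval_jetCross (J : Fin 3 → Fin 3 → ℂ) : eval (J 0) (linForm (jetCross J)) = 0 := by
  simp [eval_linForm, Fin.sum_univ_three, jetCross]; ring

/-- The linear form is `X ↦ det (Z, Z', X)`. It vanishes on `Z` and `Z'` and takes the value `jetDet
J` on `Z''`, which makes it the correction term for quadrics. -/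
theorem dirD_one_jetCross (J : Fin 3 → Fin 3 → ℂ) : dirD (J 1) (linForm (jetCross J)) = 0 := by
  rw [dirD_linForm, C_eq_zero]
  simp [Fin.sum_univ_three, jetCross]; ring

theorem dirD_two_jetCross (J : Fin 3 → Fin 3 → ℂ) :
    dirD (J 2) (linForm (jetCross J)) = C (jetDet J) := dirD_linForm _ _

/-! ### Weights under division of the lift by a function -/

/-- The quotient of the jet `J` of a point of the affine cone by the 2-jet `g` of a function. -/
noncomputable def scaledJet (J : Fin 3 → Fin 3 → ℂ) (g : Fin 3 → ℂ) : Fin 3 → Fin 3 → ℂ :=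
  fun o k => quotJet (fun o' => J o' k) g o

theorem scaledJet_zero (J : Fin 3 → Fin 3 → ℂ) (g : Fin 3 → ℂ) (h : g 0 ≠ 0) (k : Fin 3) :
    J 0 k = g 0 * scaledJet J g 0 k := by
  simp [scaledJet, quotJet]; field_simp

theorem vanForm_scaledJet (i b : Fin 3) (J : Fin 3 → Fin 3 → ℂ) (g : Fin 3 → ℂ) (h : g 0 ≠ 0) :
    vanForm i b J = C (g 0) * vanForm i b (scaledJet J g) := by
  simp only [vanForm, scaledJet_zero J g h, map_mul]; ring

/-- By antisymmetry the derivative of `g` drops out, leaving a pure power of `g 0`. The same happens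
for `jetCross` and `jetDet`. -/
theorem vanDeriv_scaledJet (i b : Fin 3) (J : Fin 3 → Fin 3 → ℂ) (g : Fin 3 → ℂ) (h : g 0 ≠ 0) :
    vanDeriv i b J = g 0 ^ 2 * vanDeriv i b (scaledJet J g) := by
  simp [vanDeriv, scaledJet, quotJet]; field_simp; ring

theorem jetCross_scaledJet (J : Fin 3 → Fin 3 → ℂ) (g : Fin 3 → ℂ) (h : g 0 ≠ 0) (k : Fin 3) :
    jetCross J k = g 0 ^ 2 * jetCross (scaledJet J g) k := by
  fin_cases k <;> simp [jetCross, scaledJet, quotJet] <;> field_simp <;> ring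

theorem linForm_jetCross_scaledJet (J : Fin 3 → Fin 3 → ℂ) (g : Fin 3 → ℂ) (h : g 0 ≠ 0) :
    linForm (jetCross J) = C (g 0 ^ 2) * linForm (jetCross (scaledJet J g)) := by
  simp only [linForm, Finset.mul_sum, jetCross_scaledJet J g h, map_mul, mul_assoc]

theorem jetDet_scaledJet (J : Fin 3 → Fin 3 → ℂ) (g : Fin 3 → ℂ) (h : g 0 ≠ 0) :
    jetDet J = g 0 ^ 3 * jetDet (scaledJet J g) := by
  simp [jetDet, jetCross, scaledJet, quotJet, Fin.sum_univ_three]; field_simp; ring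

/-! ### Polynomial dependence on the jet -/

/-- The coefficients of the ternary polynomial `Q x` are polynomials in the jet coordinates. -/
def IsPolyForm (Q : (Coord d → ℂ) → MvPolynomial (Fin 3) ℂ) : Prop :=
  ∀ α, IsPoly 0 fun x => coeff α (Q x)

namespace IsPolyForm

variable {Q R : (Coord d → ℂ) → MvPolynomial (Fin 3) ℂ}

theorem const (p : MvPolynomial (Fin 3) ℂ) : IsPolyForm (d := d) fun _ => p :=
  fun _ => IsPoly.const _

theorem C {f : (Coord d → ℂ) → ℂ} (hf : IsPoly 0 f) : IsPolyForm fun x => C (f x) := fun α => by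
  classical
  simp only [coeff_C]
  split_ifs
  exacts [hf, IsPoly.const 0]

theorem mul (hQ : IsPolyForm Q) (hR : IsPolyForm R) : IsPolyForm fun x => Q x * R x := fun α => by
  classical
  simp only [coeff_mul]
  exact IsPoly.sum _ fun p => (hQ p.1).zero_mul (hR p.2)

theorem add (hQ : IsPolyForm Q) (hR : IsPolyForm R) : IsPolyForm fun x => Q x + R x := fun α => by
  simpa only [coeff_add] using (hQ α).add (hR α)

theorem sub (hQ : IsPolyForm Q) (hR : IsPolyForm R) : IsPolyForm fun x => Q x - R x := fun α => by
  simpa only [coeff_sub] using (hQ α).sub (hR α)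

theorem vanForm (i b j : Fin 3) :
    IsPolyForm (d := d) fun x => vanForm i b (homJet j x) :=
  ((C (IsPoly.homJet j 0 i)).mul (const _)).sub ((C (IsPoly.homJet j 0 b)).mul (const _))

end IsPolyForm

theorem isPoly_vanDeriv (i b j : Fin 3) :
    IsPoly (d := d) 0 fun x => vanDeriv i b (homJet j x) :=
  ((IsPoly.homJet j 0 i).zero_mul (IsPoly.homJet j 1 b)).sub
    ((IsPoly.homJet j 0 b).zero_mul (IsPoly.homJet j 1 i))

theorem isPoly_jetCross (j k : Fin 3) : IsPoly (d := d) 0 fun x => jetCross (homJet j x) k := by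
  have h : ∀ a b, IsPoly (d := d) 0 fun x =>
      homJet j x 0 a * homJet j x 1 b - homJet j x 0 b * homJet j x 1 a := fun a b =>
    ((IsPoly.homJet j 0 a).zero_mul (IsPoly.homJet j 1 b)).sub
      ((IsPoly.homJet j 0 b).zero_mul (IsPoly.homJet j 1 a))
  fin_cases k
  exacts [h 1 2, h 2 0, h 0 1]

theorem isPoly_jetDet (j : Fin 3) : IsPoly (d := d) 0 fun x => jetDet (homJet j x) :=
  IsPoly.sum Finset.univ fun k => (isPoly_jetCross j k).zero_mul (IsPoly.homJet j 2 k)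

theorem isPolyForm_jetCross (j : Fin 3) :
    IsPolyForm (d := d) fun x => linForm (jetCross (homJet j x)) := by
  simp only [linForm, Fin.sum_univ_three]
  exact (((IsPolyForm.C (isPoly_jetCross j 0)).mul (.const _)).add
    ((IsPolyForm.C (isPoly_jetCross j 1)).mul (.const _))).add
    ((IsPolyForm.C (isPoly_jetCross j 2)).mul (.const _))

theorem vanForm_isHomogeneous (i b : Fin 3) (J : Fin 3 → Fin 3 → ℂ) :
    (vanForm i b J).IsHomogeneous 1 :=
  (isHomogeneous_C_mul_X _ _).sub (isHomogeneous_C_mul_X _ _)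

/-! ### The cubic and quadric sections -/

/-- Forms vanishing to order three at the base point give sections. -/
theorem isSection_cubic (i a b c : Fin 3) {k : ℕ} (hk : k + 3 = d) {R : MvPolynomial (Fin 3) ℂ}
    (hR : R.IsHomogeneous k) :
    IsSection d 7 1 fun j x => paramField (coeffVec d (C (homJet j x 0 i ^ 4) *
      (vanForm i a (homJet j x) * vanForm i b (homJet j x) * vanForm i c (homJet j x) * R))) := by
  refine isSection_paramField (fun J => C (J 0 i ^ 4) *
    (vanForm i a J * vanForm i b J * vanForm i c J * R)) ?_ ?_ ?_ ?_ ?_ ?_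
  · intro J
    have h := ((((vanForm_isHomogeneous i a J).mul (vanForm_isHomogeneous i b J)).mul
      (vanForm_isHomogeneous i c J)).mul hR).C_mul (J 0 i ^ 4)
    convert h using 1
    omega
  · intro j
    exact (IsPolyForm.C ((IsPoly.homJet j 0 i).pow 4)).mul ((((IsPolyForm.vanForm i a j).mul
      (IsPolyForm.vanForm i b j)).mul (IsPolyForm.vanForm i c j)).mul (.const R))
  · intro J; simp [eval_vanForm]
  · intro J; simp [eval_vanForm, Derivation.leibniz]
  · intro J; simp [secondD, eval_vanForm, Derivation.leibniz, dirD_vanForm]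
  · intro J g h
    change _ = C (g 0 ^ 7) * (C (scaledJet J g 0 i ^ 4) * (vanForm i a (scaledJet J g) *
      vanForm i b (scaledJet J g) * vanForm i c (scaledJet J g) * R))
    rw [vanForm_scaledJet i a J g h, vanForm_scaledJet i b J g h, vanForm_scaledJet i c J g h,
      scaledJet_zero J g h i]
    simp only [map_mul, map_pow]
    ring

/-- Forms vanishing to order two at the base point give sections, after a correction. -/
theorem isSection_quadric (i a b : Fin 3) {k : ℕ} (hk : k + 2 = d) {R : MvPolynomial (Fin 3) ℂ}
    (hR : R.IsHomogeneous k) :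
    IsSection d 7 1 fun j x => paramField (coeffVec d (C (homJet j x 0 i) *
      ((C (homJet j x 0 i * jetDet (homJet j x)) *
          (vanForm i a (homJet j x) * vanForm i b (homJet j x)) -
        C (2 * (vanDeriv i a (homJet j x) * vanDeriv i b (homJet j x))) *
          (X i * linForm (jetCross (homJet j x)))) * R))) := by
  refine isSection_paramField (fun J => C (J 0 i) *
    ((C (J 0 i * jetDet J) * (vanForm i a J * vanForm i b J) -
      C (2 * (vanDeriv i a J * vanDeriv i b J)) * (X i * linForm (jetCross J))) * R))
    ?_ ?_ ?_ ?_ ?_ ?_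
  · intro J
    have h := (((((vanForm_isHomogeneous i a J).mul (vanForm_isHomogeneous i b J)).C_mul
      (J 0 i * jetDet J)).sub (((isHomogeneous_X ℂ i).mul
      (linForm_isHomogeneous (jetCross J))).C_mul
      (2 * (vanDeriv i a J * vanDeriv i b J)))).mul hR).C_mul (J 0 i)
    rwa [show 1 + 1 + k = d by omega] at h
  · intro j
    exact (IsPolyForm.C (IsPoly.homJet j 0 i)).mul ((((IsPolyForm.C ((IsPoly.homJet j 0 i).zero_mul
      (isPoly_jetDet j))).mul ((IsPolyForm.vanForm i a j).mul (IsPolyForm.vanForm i b j))).sub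
      ((IsPolyForm.C (((isPoly_vanDeriv i a j).zero_mul (isPoly_vanDeriv i b j)).const_mul 2)).mul
      ((IsPolyForm.const _).mul (isPolyForm_jetCross j)))).mul (.const R))
  · intro J; simp [eval_vanForm, eval_jetCross]
  · intro J
    simp [eval_vanForm, eval_jetCross, Derivation.leibniz, dirD_vanForm, dirD_one_jetCross]
  · intro J
    simp [secondD, eval_vanForm, eval_jetCross, Derivation.leibniz, dirD_vanForm,
      dirD_one_jetCross, dirD_two_jetCross, vanDeriv]
    ring
  · intro J g h
    change _ = C (g 0 ^ 7) * (C (scaledJet J g 0 i) * ((C (scaledJet J g 0 i *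
      jetDet (scaledJet J g)) * (vanForm i a (scaledJet J g) * vanForm i b (scaledJet J g)) -
      C (2 * (vanDeriv i a (scaledJet J g) * vanDeriv i b (scaledJet J g))) *
      (X i * linForm (jetCross (scaledJet J g)))) * R))
    rw [vanForm_scaledJet i a J g h, vanForm_scaledJet i b J g h, vanDeriv_scaledJet i a J g h,
      vanDeriv_scaledJet i b J g h, jetDet_scaledJet J g h, linForm_jetCross_scaledJet J g h,
      scaledJet_zero J g h i]
    simp only [map_mul, map_pow]
    ring

/-! The sections span the tangent space -/

/-- Restriction of `paramField` to ternary polynomials, as a linear map. -/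
noncomputable def paramMap (d : ℕ) : MvPolynomial (Fin 3) ℂ →ₗ[ℂ] (Coord d → ℂ) where
  toFun Q := paramField (coeffVec d Q)
  map_add' p q := by funext c; cases c <;> simp [paramField]
  map_smul' t p := by funext c; cases c <;> simp [paramField]

/-- The ternary polynomials whose coefficient vector, as a tangent vector at `x`, is the value of
a section. -/
noncomputable def sectionForms (i : Fin 3) (x : Coord d → ℂ) :
    Submodule ℂ (MvPolynomial (Fin 3) ℂ) :=
  (sectionValues 7 1 i x).comap (paramMap d)

theorem exists_eq_sum_X_mul {m : ℕ} {p : MvPolynomial (Fin 3) ℂ} (hp : p.IsHomogeneous (m + 1)) :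
    ∃ S : Fin 3 → MvPolynomial (Fin 3) ℂ, (∀ b, (S b).IsHomogeneous m) ∧ p = ∑ b, X b * S b := by
  refine ⟨fun b => C ((m + 1 : ℂ)⁻¹) * pderiv b p, fun b => ?_, ?_⟩
  · have h := (hp.pderiv (i := b)).C_mul (m + 1 : ℂ)⁻¹
    simpa using h
  · have h := hp.sum_X_mul_pderiv
    have hm : (m + 1 : ℂ) ≠ 0 := by exact_mod_cast m.succ_ne_zero
    have h2 : ∑ b, X b * (C (m + 1 : ℂ)⁻¹ * pderiv b p) = C (m + 1 : ℂ)⁻¹ * ∑ b, X b * pderiv b p := by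
      rw [Finset.mul_sum]
      exact Finset.sum_congr rfl fun _ _ => mul_left_comm _ _ _
    rw [h2, h, nsmul_eq_mul, ← mul_assoc, ← map_natCast (C (σ := Fin 3) (R := ℂ)), ← map_mul]
    push_cast
    rw [inv_mul_cancel₀ hm, map_one, one_mul]

/-- One step of Taylor expansion at `Z`: as `Z_i = 1`, each `X_b` equals `vanForm i b J + Z_b X_i`,
and the part with `X_i` factored out has lower degree. The alternative `R b = 0` covers `m = 0`. -/
theorem exists_eq_add_sum_vanForm (i : Fin 3) (J : Fin 3 → Fin 3 → ℂ) (hJ : J 0 i = 1) (m : ℕ)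
    (p : MvPolynomial (Fin 3) ℂ) (hp : p.IsHomogeneous m) :
    ∃ (c : ℂ) (R : Fin 3 → MvPolynomial (Fin 3) ℂ),
      p = C c * X i ^ m + ∑ b, vanForm i b J * R b ∧
        ∀ b, R b = 0 ∨ ∃ k, k + 1 = m ∧ (R b).IsHomogeneous k := by
  induction m generalizing p with
  | zero =>
    obtain ⟨c, rfl⟩ : ∃ c, p = C c :=
      ⟨_, totalDegree_eq_zero_iff_eq_C.1 ((totalDegree_zero_iff_isHomogeneous _).2 hp)⟩
    exact ⟨c, 0, by simp, fun _ => Or.inl rfl⟩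
  | succ m ih =>
    obtain ⟨S, hS, rfl⟩ := exists_eq_sum_X_mul hp
    obtain ⟨c, R, hR, hR'⟩ := ih (∑ b, C (J 0 b) * S b)
      (IsHomogeneous.sum _ _ _ fun b _ => (hS b).C_mul _)
    refine ⟨c, fun b => S b + X i * R b, ?_, fun b => Or.inr ⟨m, rfl, (hS b).add ?_⟩⟩
    · have h : ∑ b, X b * S b = ∑ b, vanForm i b J * S b + X i * ∑ b, C (J 0 b) * S b := by
        rw [Finset.mul_sum, ← Finset.sum_add_distrib]
        refine Finset.sum_congr rfl fun b _ => ?_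
        simp only [vanForm, hJ, map_one]; ring
      rw [h, hR]
      simp only [mul_add, Finset.sum_add_distrib, Finset.mul_sum]
      rw [pow_succ]
      have h2 : ∑ b, X i * (vanForm i b J * R b) = ∑ b, vanForm i b J * (X i * R b) :=
        Finset.sum_congr rfl fun b _ => mul_left_comm _ _ _
      rw [h2]; ring
    · rcases hR' b with h | ⟨k, rfl, h⟩
      · rw [h, mul_zero]; exact isHomogeneous_zero _ _ _
      · have := (isHomogeneous_X ℂ i).mul h
        rwa [add_comm] at this

theorem cubic_mem_sectionForms (i a b c : Fin 3) (x : Coord d → ℂ) {k : ℕ} (hk : k + 3 = d)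
    {R : MvPolynomial (Fin 3) ℂ} (hR : R.IsHomogeneous k) :
    vanForm i a (homJet i x) * (vanForm i b (homJet i x) * (vanForm i c (homJet i x) * R)) ∈
      sectionForms i x := by
  refine ⟨_, isSection_cubic i a b c hk hR, ?_⟩
  simp [paramMap, homJet_self, mul_assoc]

/-- Every form is a combination of values of sections, modulo linear forms. -/
theorem mem_sectionForms_sup_span (hd : 1 ≤ d) (i : Fin 3) (x : Coord d → ℂ)
    (hW : jetDet (homJet i x) ≠ 0) (p : MvPolynomial (Fin 3) ℂ) (hp : p.IsHomogeneous d) :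
    p ∈ sectionForms i x ⊔ Submodule.span ℂ
      (Set.range fun b => (X i : MvPolynomial (Fin 3) ℂ) ^ (d - 1) * X b) := by
  set J := homJet i x with hJ
  set T := sectionForms i x ⊔ Submodule.span ℂ
    (Set.range fun b => (X i : MvPolynomial (Fin 3) ℂ) ^ (d - 1) * X b) with hT
  have hJi : J 0 i = 1 := homJet_zero_self i x
  have hC : ∀ (c : ℂ) p, p ∈ T → C c * p ∈ T := fun c p hp => by
    rw [← smul_eq_C_mul]; exact T.smul_mem c hp
  have hX : ∀ b, (X i : MvPolynomial (Fin 3) ℂ) ^ (d - 1) * X b ∈ T := fun b =>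
    Submodule.mem_sup_right (Submodule.subset_span ⟨b, rfl⟩)
  have hlin : ∀ c, X i ^ (d - 1) * linForm c ∈ T := fun c => by
    rw [linForm, Finset.mul_sum]
    refine T.sum_mem fun b _ => ?_
    rw [mul_left_comm]
    exact hC _ _ (hX b)
  have hcubic : ∀ a b c (k : ℕ) R, R.IsHomogeneous k → k + 3 = d →
      vanForm i a J * (vanForm i b J * (vanForm i c J * R)) ∈ T := fun a b c k R hR hk =>
    Submodule.mem_sup_left (cubic_mem_sectionForms i a b c x hk hR)
  -- The correction term is `X_i^(d-1)` times a linear form, so it lies in the span; dividing by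
  -- `jetDet J` is where the Wronskian must be nonzero.
  have hquadric : ∀ a b (k : ℕ), k + 2 = d →
      vanForm i a J * (vanForm i b J * X i ^ k) ∈ T := fun a b k hk => by
    have h1 : (C (jetDet J) * (vanForm i a J * vanForm i b J) -
        C (2 * (vanDeriv i a J * vanDeriv i b J)) * (X i * linForm (jetCross J))) * X i ^ k ∈ T := by
      refine Submodule.mem_sup_left ⟨_, isSection_quadric i a b hk (isHomogeneous_X_pow i k), ?_⟩
      simp [paramMap, homJet_self, hJ]
    have h2 := hC (2 * (vanDeriv i a J * vanDeriv i b J)) _ (hlin (jetCross J))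
    have h3 := hC (jetDet J)⁻¹ _ (T.add_mem h1 h2)
    have h4 : C (jetDet J)⁻¹ * C (jetDet J) = (1 : MvPolynomial (Fin 3) ℂ) := by
      rw [← map_mul, inv_mul_cancel₀ hW, map_one]
    convert h3 using 1
    rw [show d - 1 = k + 1 by omega]
    linear_combination (-(vanForm i a J * vanForm i b J * X i ^ k)) * h4
  have hone : ∀ a (k : ℕ), k + 1 = d → vanForm i a J * X i ^ k ∈ T := fun a k hk => by
    have h : vanForm i a J * X i ^ k = X i ^ (d - 1) * X a -
        C (J 0 a) * (X i ^ (d - 1) * X i) := by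
      rw [show d - 1 = k by omega, vanForm, hJi, map_one]; ring
    rw [h]
    exact T.sub_mem (hX a) (hC _ _ (hX i))
  have hzero : (X i : MvPolynomial (Fin 3) ℂ) ^ d ∈ T := by
    have := hX i
    rwa [← pow_succ, Nat.sub_add_cancel hd] at this
  have hmul : ∀ (q₁ q₂ : MvPolynomial (Fin 3) ℂ) (c : ℂ), q₁ * (C c * q₂) = C c * (q₁ * q₂) := fun q₁ q₂ c =>
    mul_left_comm _ _ _
  -- Three successive expansions give the Taylor expansion at `Z` with a cubic remainder. For small
  -- `d` it stops early through the branches with zero remainder.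
  obtain ⟨c, R, rfl, hR⟩ := exists_eq_add_sum_vanForm i J hJi d p hp
  refine T.add_mem (hC _ _ hzero) (T.sum_mem fun a _ => ?_)
  rcases hR a with h | ⟨k, hk, h⟩
  · rw [h, mul_zero]; exact T.zero_mem
  obtain ⟨c₁, R₁, h₁, hR₁⟩ := exists_eq_add_sum_vanForm i J hJi k _ h
  rw [h₁, mul_add, Finset.mul_sum, hmul]
  refine T.add_mem (hC _ _ (hone a k hk)) (T.sum_mem fun b _ => ?_)
  rcases hR₁ b with h | ⟨k', hk', h⟩
  · rw [h, mul_zero, mul_zero]; exact T.zero_mem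
  obtain ⟨c₂, R₂, h₂, hR₂⟩ := exists_eq_add_sum_vanForm i J hJi k' _ h
  rw [h₂, mul_add, mul_add, Finset.mul_sum, Finset.mul_sum, hmul, hmul]
  refine T.add_mem (hC _ _ (hquadric a b k' (by omega))) (T.sum_mem fun e _ => ?_)
  rcases hR₂ e with h | ⟨k'', hk'', h⟩
  · rw [h, mul_zero, mul_zero, mul_zero]; exact T.zero_mem
  · exact hcubic a b e k'' _ h (by omega)

theorem det_eq_jetDet (J : Fin 3 → Fin 3 → ℂ) : (Matrix.of J).det = jetDet J := by
  simp [Matrix.det_fin_three, jetDet, jetCross, Fin.sum_univ_three]; ring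

/-- A tangent vector in the parameter direction is the value of a section. -/
theorem paramField_mem_sectionValues (hd : 1 ≤ d) (i : Fin 3) (x : Coord d → ℂ)
    (hx : x ∈ jetChart d i) (hW : jetDet (homJet i x) ≠ 0) (b : Idx d → ℂ)
    (hb : paramField b ∈ tangentSpace i x) : paramField b ∈ sectionValues 7 1 i x := by
  set J := homJet i x with hJ
  have hJ0 : J 0 i = 1 := homJet_self i x 0
  have hJ1 : J 1 i = 0 := homJet_self i x 1
  have hJ2 : J 2 i = 0 := homJet_self i x 2
  obtain ⟨κ, hκ, q, hq, hsum⟩ := Submodule.mem_sup.1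
    (mem_sectionForms_sup_span hd i x hW (form b) (form_isHomogeneous b))
  obtain ⟨c, rfl⟩ := (Submodule.mem_span_range_iff_exists_fun ℂ).1 hq
  have hq' : ∑ k, c k • ((X i : MvPolynomial (Fin 3) ℂ) ^ (d - 1) * X k) =
      X i ^ (d - 1) * linForm c := by
    simp only [linForm, Finset.mul_sum, smul_eq_C_mul, mul_left_comm]
  rw [hq'] at hsum
  have hlin : (X i ^ (d - 1) * linForm c).IsHomogeneous d := by
    have h := (isHomogeneous_X_pow (R := ℂ) i (d - 1)).mul (linForm_isHomogeneous c)
    rwa [Nat.sub_add_cancel hd] at h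
  have hκt : paramMap d κ ∈ tangentSpace i x := by
    obtain ⟨V, hV, hVκ⟩ := hκ
    rw [← hVκ]
    exact hV.tangent i x hx
  have ht : paramField (coeffVec d (X i ^ (d - 1) * linForm c)) ∈ tangentSpace i x := by
    have h : paramMap d (X i ^ (d - 1) * linForm c) = paramMap d (form b) - paramMap d κ := by
      rw [← hsum, map_add, add_sub_cancel_left]
    change paramMap d _ ∈ _
    rw [h]
    refine Submodule.sub_mem _ ?_ hκt
    change paramField (coeffVec d (form b)) ∈ _
    rwa [coeffVec_form]
  rw [mem_tangentSpace_iff, dEqns_paramField, form_coeffVec _ hlin] at ht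
  have t0 := congrFun ht 0
  have t1 := congrFun ht 1
  have t2 := congrFun ht 2
  -- Along the normalised jet `X_i` is constantly 1, so the factor `X_i^(d-1)` disappears and
  -- tangency reads `c·Z = c·Z' = c·Z'' = 0`.
  simp [← hJ, secondD, Derivation.leibniz, Derivation.leibniz_pow, hJ0, hJ1, hJ2, eval_linForm,
    dirD_linForm] at t0 t1 t2
  have hc : c = 0 := by
    refine Matrix.eq_zero_of_mulVec_eq_zero (M := Matrix.of J) (by rwa [det_eq_jetDet]) ?_
    funext o
    simp only [Matrix.mulVec, dotProduct, Matrix.of_apply, mul_comm (J _ _)]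
    fin_cases o
    exacts [t0, t1, t2]
  have hb' : form b = κ := by
    rw [← hsum, hc]; simp [linForm]
  rw [← coeffVec_form b, hb']
  exact hκ

/-- Where the Wronskian and `Z₃` do not vanish, every tangent vector is the value of a section. -/
theorem mem_sectionValues (hd : 1 ≤ d) (i : Fin 3) (x : Coord d → ℂ) (hx : x ∈ jetChart d i)
    (hW : jetDet (homJet i x) ≠ 0) (hl : x (.l 0) ≠ 0) (v : Coord d → ℂ)
    (hv : v ∈ tangentSpace i x) : v ∈ sectionValues 7 1 i x := by
  set J := homJet i x with hJ
  have hJ0 : J 0 i = 1 := homJet_self i x 0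
  have hJ1 : J 1 i = 0 := homJet_self i x 1
  have hJ2 : J 2 i = 0 := homJet_self i x 2
  -- The rescaling that produces the components of `v` along `Z₃`; since `l 0` is an ordinary
  -- coordinate, its entry requires `Z₃ ≠ 0`.
  set γ : Fin 3 → ℂ := ![v (.l 0) / x (.l 0), v (.l 1), v (.l 2)] with hγ
  -- `M` is prescribed on the basis `Z, Z', Z''`.
  obtain ⟨M, hM⟩ : ∃ M : Matrix (Fin 3) (Fin 3) ℂ, ∀ o k, M.mulVec (J o) k =
      dJet i v o k - mulJet γ (fun o' => J o' k) o := by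
    let T : Matrix (Fin 3) (Fin 3) ℂ :=
      Matrix.of fun o k => dJet i v o k - mulJet γ (fun o' => J o' k) o
    refine ⟨((Matrix.of J)⁻¹ * T).transpose, fun o k => ?_⟩
    have h : Matrix.of J * ((Matrix.of J)⁻¹ * T) = T := by
      rw [← mul_assoc, Matrix.mul_nonsing_inv, one_mul]
      rw [det_eq_jetDet]; exact hW.isUnit
    have h' := congrFun (congrFun h o) k
    rw [Matrix.mul_apply] at h'
    simpa [Matrix.mulVec, dotProduct, mul_comm] using h'.trans (Matrix.of_apply _ _ _)
  -- The `i`-th components are `(1, 0, 0)` along the jet and do not vary, so the prescription of `M`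
  -- already forces its rescaling to be `γ`.
  have hs : ∀ o, scaleJet M i x o = γ o := fun o => by
    rw [scaleJet, hM, dJet_self]
    fin_cases o <;> simp [mulJet, hJ0, hJ1, hJ2]
  have hgl : glField M i x ∈ sectionValues 7 1 i x := by
    refine ⟨_, (isSection_glField hd M).mul_pow i 7, ?_⟩
    simp [homJet_self]
  have hdiff : v = glField M i x + paramField (coeffs (v - glField M i x)) := by
    funext c
    cases c with
    | w o k =>
      have h : glField M i x (.w o k) = v (.w o k) := by
        rw [← dJet_succAbove i (glField M i x), ← dJet_succAbove i v, dJet_glField, hM,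
          show scaleJet M i x = γ from funext hs]
        exact sub_add_cancel _ _
      simp [paramField, h]
    | l o =>
      have h : glField M i x (.l o) = v (.l o) := by
        fin_cases o <;> simp [glField, hs, hγ, hl]
      simp [paramField, h]
    | a α => simp [paramField, coeffs]
  have hb : paramField (coeffs (v - glField M i x)) ∈ tangentSpace i x := by
    rw [← sub_eq_of_eq_add' hdiff]
    exact Submodule.sub_mem _ hv ((isSection_glField hd M).tangent i x hx)
  rw [hdiff]
  exact Submodule.add_mem _ hgl (paramField_mem_sectionValues hd i x hx hW _ hb)

/-! The change of coordinates preserves the log jet space -/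

/-- Dividing the lift by the jet of `Z_j` multiplies the jet of the equation by that of `Z_j^(-d)`,
so each new equation is a triangular combination of the old ones. -/
theorem eqns_transition (i j : Fin 3) (x : Coord d → ℂ) (h : homJet i x 0 j ≠ 0)
    (hx : eqns d i x = 0) : eqns d j (transition d i j x) = 0 := by
  set Z := homJet i x with hZ
  set t := (Z 0 j)⁻¹ with ht
  have h0 : homJet j (transition d i j x) 0 = t • Z 0 := by
    funext k
    rw [homJet_transition_eq_quotJet i j x h]
    simp [quotJet]
    ring
  have h1 : homJet j (transition d i j x) 1 = t • (Z 1 - (t * Z 1 j) • Z 0) := by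
    funext k
    rw [homJet_transition_eq_quotJet i j x h]
    simp [quotJet]
    ring
  have h2 : homJet j (transition d i j x) 2 =
      t • (Z 2 - (2 * t * Z 1 j) • Z 1 + (2 * t ^ 2 * Z 1 j ^ 2 - t * Z 2 j) • Z 0) := by
    funext k
    rw [homJet_transition_eq_quotJet i j x h]
    simp [quotJet]
    ring
  have hl0 : transition d i j x (.l 0) = t * x (.l 0) := by
    simp [transition, quotLogJet]; ring
  have hl1 : transition d i j x (.l 1) = x (.l 1) - t * Z 1 j := by
    simp [transition, quotLogJet]; ring
  have hl2 : transition d i j x (.l 2) = x (.l 2) - (t * Z 2 j - t ^ 2 * Z 1 j ^ 2) := by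
    simp [transition, quotLogJet]; ring
  have ha : coeffs (transition d i j x) = coeffs x := rfl
  have e0 := congrFun hx 0
  have e1 := congrFun hx 1
  have e2 := congrFun hx 2
  simp only [eqns_zero, eqns_one, eqns_two, secondD, Pi.zero_apply, map_add] at e0 e1 e2
  have hP := form_isHomogeneous (coeffs x)
  have E0 := eval_dirD_self (Z 0) _ hP
  have E1 := fun u => eval_dirD_dirD_self (Z 0) u _ hP
  funext o
  fin_cases o <;> simp only [Fin.zero_eta, Fin.mk_one, Fin.reduceFinMk, eqns_zero, eqns_one,
    eqns_two, h0, h1, h2, hl0, hl1, hl2, ha, secondD, map_add, eval_smul_dirD_form,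
    eval_smul_dirD_dirD_form, eval_form_smul, Pi.zero_apply, mul_pow]
  · linear_combination t ^ d * e0
  · simp only [sub_eq_add_neg, ← neg_smul, dirD_add, dirD_smul, Derivation.add_apply,
      Derivation.smul_apply, map_add, smul_eval, E0]
    linear_combination t ^ d * e1 - t ^ d * d * t * Z 1 j * e0
  · simp only [sub_eq_add_neg, ← neg_smul, dirD_add, dirD_smul, Derivation.add_apply,
      Derivation.smul_apply, map_add, smul_eval, Derivation.map_smul, dirD_comm (Z 1) (Z 0), E0, E1]
    linear_combination t ^ d * e2 - t ^ d * 2 * d * t * Z 1 j * e1 +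
      t ^ d * (d * (2 * t ^ 2 * Z 1 j ^ 2 - t * Z 2 j) + d * (d - 1) * t ^ 2 * Z 1 j ^ 2) * e0

theorem transition_mem_jetChart (i j : Fin 3) (x : jetChart d i) (h : homJet i x.1 0 j ≠ 0) :
    transition d i j x.1 ∈ jetChart d j :=
  ⟨x.2.1, eqns_transition i j x.1 h x.2.2⟩

theorem ofChart_eq_transition (i j : Fin 3) (x : jetChart d i) (h : homJet i x.1 0 j ≠ 0) :
    ofChart i x = ofChart j ⟨transition d i j x.1, transition_mem_jetChart i j x h⟩ :=
  Quot.sound ⟨h, rfl⟩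

/-! The closure of the Wronskian locus away from `H` -/

theorem jetDet_homJet (i : Fin 3) (x : Coord d → ℂ) :
    jetDet (homJet i x) = (-1) ^ (i : ℕ) * wronskian x := by
  have h₀ := homJet_self i x
  have h₁ := fun o => homJet_succAbove i x o 0
  have h₂ := fun o => homJet_succAbove i x o 1
  fin_cases i
  · change ∀ o, homJet 0 x o 0 = _ at h₀
    change ∀ o, homJet 0 x o 1 = _ at h₁
    change ∀ o, homJet 0 x o 2 = _ at h₂
    simp [jetDet, jetCross, h₀, h₁, h₂, Fin.sum_univ_three, wronskian]
    ring
  · change ∀ o, homJet 1 x o 1 = _ at h₀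
    change ∀ o, homJet 1 x o 0 = _ at h₁
    change ∀ o, homJet 1 x o 2 = _ at h₂
    simp [jetDet, jetCross, h₀, h₁, h₂, Fin.sum_univ_three, wronskian]
    ring
  · change ∀ o, homJet 2 x o 2 = _ at h₀
    change ∀ o, homJet 2 x o 0 = _ at h₁
    change ∀ o, homJet 2 x o 1 = _ at h₂
    simp [jetDet, jetCross, h₀, h₁, h₂, Fin.sum_univ_three, wronskian]
    ring

theorem jetDet_homJet_eq_zero_iff (i : Fin 3) (x : Coord d → ℂ) :
    jetDet (homJet i x) = 0 ↔ wronskian x = 0 := by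
  rw [jetDet_homJet]; simp

theorem wronskian_transition (i j : Fin 3) (x : Coord d → ℂ) (h : homJet i x 0 j ≠ 0)
    (hx : wronskian x = 0) : wronskian (transition d i j x) = 0 := by
  rw [← jetDet_homJet_eq_zero_iff i, jetDet_scaledJet _ (fun o' => homJet i x o' j) h] at hx
  rw [← jetDet_homJet_eq_zero_iff j]
  have h2 : homJet j (transition d i j x) = scaledJet (homJet i x) fun o' => homJet i x o' j := by
    funext o k
    exact homJet_transition_eq_quotJet i j x h o k
  rw [h2]
  exact (mul_eq_zero.1 hx).resolve_left (pow_ne_zero 3 h)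

/-- The exponent of `Z_i^d`. -/
def pureIdx (d : ℕ) (i : Fin 3) : Idx d :=
  ⟨Pi.single i d, by rw [Finset.Nat.mem_antidiagonalTuple]; simp⟩

theorem form_single_pureIdx (i : Fin 3) (t : ℂ) :
    form (Pi.single (pureIdx d i) t) = C t * X i ^ d := by
  classical
  rw [form, Finset.sum_eq_single (pureIdx d i)]
  · rw [Pi.single_eq_same, Finset.prod_eq_single i]
    · simp [pureIdx]
    · intro j _ hj; simp [pureIdx, hj]
    · simp
  · intro α _ hα; simp [hα]
  · simp

/-- Moves `x` to a point of the log jet space with the same jet coordinates in `ℙ²`, by changing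
the coefficient of `Z_i^d` and the coordinates `ξ_3^{(1)}`, `ξ_3^{(2)}`. -/
noncomputable def correct (i : Fin 3) (x : Coord d → ℂ) : Coord d → ℂ :=
  let y := Function.update x (.a (pureIdx d i)) (x (.a (pureIdx d i)) - eqns d i x 0)
  let z := Function.update y (.l 1) (y (.l 1) - eqns d i y 1 / (d * x (.l 0) ^ d))
  Function.update z (.l 2) (z (.l 2) - eqns d i z 2 / (d * x (.l 0) ^ d))

theorem homJet_congr (i : Fin 3) {x y : Coord d → ℂ} (h : ∀ o k, x (.w o k) = y (.w o k)) :
    homJet i x = homJet i y := by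
  funext o
  simp only [homJet, h]

theorem homJet_correct (i : Fin 3) (x : Coord d → ℂ) : homJet i (correct i x) = homJet i x :=
  homJet_congr i fun o k => by simp [correct]

theorem correct_l_zero (i : Fin 3) (x : Coord d → ℂ) : correct i x (.l 0) = x (.l 0) := by
  simp [correct]

theorem correct_eq_self (i : Fin 3) (x : Coord d → ℂ) (hx : eqns d i x = 0) :
    correct i x = x := by
  simp [correct, hx]

/-- The system is triangular: the coefficient of `Z_i^d` enters the first equation with factor 1,
because `Z_i = 1`, and `ξ_3^{(1)}`, `ξ_3^{(2)}` first appear, linearly with factor `d Z₃^d ≠ 0`, in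
the second and third. -/
theorem eqns_correct (hd : 1 ≤ d) (i : Fin 3) (x : Coord d → ℂ) (hl : x (.l 0) ≠ 0) :
    eqns d i (correct i x) = 0 := by
  have hd' : (d : ℂ) ≠ 0 := by exact_mod_cast (by omega : d ≠ 0)
  simp only [correct]
  set y := Function.update x (.a (pureIdx d i)) (x (.a (pureIdx d i)) - eqns d i x 0) with hy
  set z := Function.update y (.l 1) (y (.l 1) - eqns d i y 1 / (d * x (.l 0) ^ d)) with hz
  set t := Function.update z (.l 2) (z (.l 2) - eqns d i z 2 / (d * x (.l 0) ^ d)) with ht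
  have jy : homJet i y = homJet i x := homJet_congr i fun o k => by simp [hy]
  have jz : homJet i z = homJet i x := by rw [← jy]; exact homJet_congr i fun o k => by simp [hz]
  have jt : homJet i t = homJet i x := by rw [← jz]; exact homJet_congr i fun o k => by simp [ht]
  have az : coeffs z = coeffs y := by funext α; simp [coeffs, hz]
  have aeq : coeffs t = coeffs y := by funext α; simp [coeffs, ht, hz]
  have ay : coeffs y = coeffs x + Pi.single (pureIdx d i) (-eqns d i x 0) := by
    funext α
    by_cases h : α = pureIdx d i
    · subst h; simp [coeffs, hy, sub_eq_add_neg]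
    · simp [coeffs, hy, h]
  have y0 : y (.l 0) = x (.l 0) := by simp [hy]
  have z0 : z (.l 0) = x (.l 0) := by simp [hz, y0]
  have t0 : t (.l 0) = x (.l 0) := by simp [ht, z0]
  have z1 : z (.l 1) = y (.l 1) - eqns d i y 1 / (d * x (.l 0) ^ d) := by simp [hz]
  have t1 : t (.l 1) = z (.l 1) := by simp [ht]
  have t2 : t (.l 2) = z (.l 2) - eqns d i z 2 / (d * x (.l 0) ^ d) := by simp [ht]
  have e0 : eqns d i t 0 = 0 := by
    rw [eqns_zero, jt, aeq, t0, ay, form_add, form_single_pureIdx, map_add]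
    simp [homJet_self, eqns_zero]
  have e1 : eqns d i t 1 = 0 := by
    have h := eqns_one i y
    rw [jy, y0] at h
    rw [eqns_one, jt, aeq, t0, t1, z1]
    field_simp
    linear_combination -h
  have e2 : eqns d i t 2 = 0 := by
    have h := eqns_two i z
    rw [jz, az, z0] at h
    rw [eqns_two, jt, aeq, t0, t1, t2]
    field_simp
    linear_combination -h
  funext o
  fin_cases o
  exacts [e0, e1, e2]

theorem coeffs_ne_zero_of_eqns (i : Fin 3) (x : Coord d → ℂ) (hl : x (.l 0) ≠ 0)
    (hx : eqns d i x = 0) : coeffs x ≠ 0 := by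
  intro h
  have h0 := congrFun hx 0
  rw [eqns_zero, h] at h0
  simp [form, hl] at h0

theorem continuous_correct {T : Type*} [TopologicalSpace T] (i : Fin 3) {f : T → Coord d → ℂ}
    (hf : Continuous f) (hl : ∀ t, f t (.l 0) ≠ 0) (hd : 1 ≤ d) :
    Continuous fun t => correct i (f t) := by
  have hd' : (d : ℂ) ≠ 0 := by exact_mod_cast (by omega : d ≠ 0)
  have he : ∀ (g : T → Coord d → ℂ) o, Continuous g → Continuous fun t => eqns d i (g t) o :=
    fun g o hg => (continuous_apply o).comp ((differentiable_eqns i).continuous.comp hg)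
  have hc : ∀ (g : T → Coord d → ℂ) c, Continuous g → Continuous fun t => g t c :=
    fun g c hg => (continuous_apply c).comp hg
  have hD : ∀ t, (d : ℂ) * f t (.l 0) ^ d ≠ 0 := fun t => mul_ne_zero hd' (pow_ne_zero _ (hl t))
  have hDc : Continuous fun t => (d : ℂ) * f t (.l 0) ^ d :=
    continuous_const.mul ((hc f _ hf).pow d)
  have hy := hf.update (.a (pureIdx d i)) ((hc f (.a (pureIdx d i)) hf).sub (he f 0 hf))
  have hz := hy.update (.l 1) ((hc _ (.l 1) hy).sub ((he _ 1 hy).div hDc hD))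
  exact hz.update (.l 2) ((hc _ (.l 2) hz).sub ((he _ 2 hz).div hDc hD))

theorem ofChart_mem_of_wronskian (i : Fin 3) (x : jetChart d i) (hW : wronskian x.1 = 0)
    (h : homJet i x.1 0 0 ≠ 0) :
    ofChart i x ∈ {q | ∃ x : jetChart d 0, q = ofChart 0 x ∧ wronskian x.1 = 0} :=
  ⟨_, ofChart_eq_transition i 0 x h, wronskian_transition i 0 x.1 h hW⟩

/-- Only jets over `Z₀ = 0` need an argument. There `Z₀` is a free affine coordinate that does not
enter the Wronskian, and neither do the coordinates altered by `correct`. -/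
theorem mem_wronskianLocus (hd : 1 ≤ d) (i : Fin 3) (x : jetChart d i) (hl : x.1 (.l 0) ≠ 0)
    (hW : wronskian x.1 = 0) : ofChart i x ∈ wronskianLocus d := by
  by_cases h : homJet i x.1 0 0 = 0
  swap
  · exact subset_closure (ofChart_mem_of_wronskian i x hW h)
  obtain ⟨k, hk⟩ : ∃ k, (0 : Fin 3) = i.succAbove k := by
    rcases Fin.eq_self_or_eq_succAbove i 0 with h' | h'
    · subst h'; rw [homJet_zero_self] at h; exact absurd h one_ne_zero
    · exact h'
  -- Set `Z₀ = t`; for `t ≠ 0` the corrected jet lies over the chart `Z₀ ≠ 0`, and at `t = 0` it is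
  -- `x` itself.
  let f : ℂ → Coord d → ℂ := fun t => Function.update x.1 (.w 0 k) (x.1 (.w 0 k) + t)
  have hf : Continuous f := continuous_const.update _ (continuous_const.add continuous_id)
  have hfl : ∀ t, f t (.l 0) = x.1 (.l 0) := fun t => by simp [f]
  have hfl' : ∀ t, f t (.l 0) ≠ 0 := fun t => by rwa [hfl]
  have hmem : ∀ t, correct i (f t) ∈ jetChart d i := fun t =>
    have h := eqns_correct hd i (f t) (hfl' t)
    ⟨coeffs_ne_zero_of_eqns i _ (by rw [correct_l_zero]; exact hfl' t) h, h⟩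
  let γ : ℂ → jetChart d i := fun t => ⟨correct i (f t), hmem t⟩
  have hγ : Continuous γ := (continuous_correct i hf hfl' hd).subtype_mk _
  have hc : Continuous (ofChart (d := d) i) := continuous_quot_mk.comp continuous_sigmaMk
  have hγ0 : γ 0 = x := by
    apply Subtype.ext
    change correct i (f 0) = x.1
    have : f 0 = x.1 := by simp [f]
    rw [this, correct_eq_self i _ x.2.2]
  rw [← hγ0]
  refine map_mem_closure (f := fun t => ofChart i (γ t)) (s := {0}ᶜ) (hc.comp hγ)
    ((dense_compl_singleton (0 : ℂ)) 0) fun t ht => ?_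
  refine ofChart_mem_of_wronskian i (γ t) ?_ ?_
  · simpa [wronskian, γ, correct, f] using hW
  · change homJet i (correct i (f t)) 0 0 ≠ 0
    have h2 : homJet i (f t) 0 0 = homJet i x.1 0 0 + t := by
      rw [hk, homJet_succAbove, homJet_succAbove, ← hk]
      simp [f]
    rw [homJet_correct, h2, h, zero_add]
    exact ht

theorem mem_divH (i : Fin 3) (x : jetChart d i) (hl : x.1 (.l 0) = 0) :
    proj d (ofChart i x) ∈ divH d := by
  obtain ⟨t, ht⟩ := Projectivization.exists_smul_eq_mk_rep ℂ (homPt i x.1) (homPt_ne_zero i x.1)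
  change (Projectivization.mk ℂ (homPt i x.1) (homPt_ne_zero i x.1)).rep 3 = 0
  rw [← ht]
  change (t : ℂ) * homPt i x.1 3 = 0
  rw [homPt_three, hl, mul_zero]

end LogJets

theorem mainTheorem3 (d : ℕ) (hd : 1 ≤ d) :
    ∃ e : ℕ, ∀ (i : Fin 3) (x : LogJets.jetChart d i),
      LogJets.ofChart i x ∉ LogJets.wronskianLocus d ∪ LogJets.proj d ⁻¹' LogJets.divH d →
      ∀ v ∈ LogJets.tangentSpace i x.1,
        ∃ s : LogJets.GlobalSection d 7 e, s.value i x.1 = v := by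
  -- The `𝔤𝔩₃` fields are linear in the `a_α` and the parameter fields do not involve them, so `e =
  -- 1` serves for every `d`.
  refine ⟨1, fun i x hx v hv => ?_⟩
  have hl : x.1 (.l 0) ≠ 0 := fun h => hx (Or.inr (LogJets.mem_divH i x h))
  have hW : LogJets.jetDet (LogJets.homJet i x.1) ≠ 0 := fun h =>
    hx (Or.inl (LogJets.mem_wronskianLocus hd i x hl
      ((LogJets.jetDet_homJet_eq_zero_iff i x.1).1 h)))
  obtain ⟨V, hV, rfl⟩ := LogJets.mem_sectionValues hd i x.1 x.2 hW hl v hv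
  obtain ⟨s, hs⟩ := hV.exists_globalSection
  exact ⟨s, hs i x.1⟩
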